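/- Let $M$ be a finite average-reward MDP with $S\ge 2$ states, $A$ actions, transition probabilities $p_{s,a}$ and known mean rewards $\bar r_{s,a}\in[0,1]$. A policy is a map from states to actions; $P_\pi,\bar r_\pi$ are its transition matrix and mean reward vector, $g_\pi(s)=\lim_T \frac1T\sum_{t<T}(P_\pi^t\bar r_\pi)(s)$ is its gain, and $g^\star=\max_\pi g_\pi$. Suppose that $M$ is unichain (under every policy the Markov chain has a single recurrent class, plus possibly transient states) and that some policy is not optimal. Fix a reference state $s_1$. *Complexity constants.* The optimal bias $b^\star$ is the solution, unique up to an additive constant, of $g^\star+b^\star(s)=\max_a(\bar r_{s,a}+p_{s,a}b^\star)$, and $H=\max_s b^\star(s)-\min_s b^\star(s)$. For a policy $\pi$ with bias $b_\pi$ (a solution of $g_\pi+(I-P_\pi)b_\pi=\bar r_\pi$), $h_\pi$ is the vector with coordinate $g_\pi$ at $s_1$ and $b_\pi(s)-b_\pi(s_1)$ at $s\neq s_1$, and $\Pi_\pi$ is the matrix whose column $s_1$ is all ones and whose other columns are those of $I-P_\pi$, so that $\Pi_\pi h_\pi=\bar r_\pi$. Put $\delta_1=\min_{\pi:\,g_\pi\ne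 g^\star}|g_\pi-g^\star|$, $\Delta_1=\max_\pi\|\Pi_\pi^{-1}\|_{\infty\to\infty}$, $\Delta_2=\max_\pi\|h_\pi\|_\infty$ and $\Gamma_M=\Delta_1(\Delta_2+\delta_1/2)$. *Algorithm.* Let $\varepsilon,\delta\in(0,1)$. In each round $k=1,2,\dots$ one next state is drawn independently from $p_{s,a}$ for every pair $(s,a)$. Let $\hat p_{s,a}$ be the empirical distribution of the $k$ samples of $(s,a)$, and $b$ the optimal bias, normalised by $b(s_1)=0$, of the MDP with rewards $\bar r$ and transitions $\hat p$ (if that MDP has no constant optimal gain and bias solving its optimality equation, $b$ is an arbitrary function of that MDP; if there are several solutions, any one of them may be used). With $$x(\delta,k)=\log\frac{SA}{\delta}+(S-1)\log\Big(e\Big(1+\frac{k}{S-1}\Big)\Big),$$ let $U_{s,a}$ and $L_{s,a}$ be the maximum and the minimum of $p'b$ over probability vectors $p'$ with $k\,\mathrm{KL}(\hat p_{s,a},p')\le x(\delta,k)$, or alternatively the relaxations $\hat p_{s,a}b\pm\|b\|_\infty\sqrt{2x(\delta,k)/k}$. The algorithm stops after the first round in which $$\max_s\max_a\big(\bar r_{s,a}+U_{s,a}-b(s)\big)-\min_s\max_a\big(\bar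 r_{s,a}+L_{s,a}-b(s)\big)\le\varepsilon .$$ Its sample complexity $\tau$ is $SA$ times the number of rounds. **Theorem.** For either choice of confidence bounds: 1. With probability at least $1-\delta$, $$\tau<SA(S-1)\,\frac{y}{C}\Big(1+\frac{2}{y}\log\frac{y+2}{C}\Big),\qquad y=1+\frac{\ln(SA/\delta)}{S-1},\quad C=\frac1{288}\,\frac{\min(\delta_1,\varepsilon)^2}{\max(H+1,\Gamma_M)^2}.$$ 2. There is a universal constant $K>0$ such that, whenever $\varepsilon\le\delta_1$, with probability at least $1-\delta$, $$\tau\le K\,\frac{SA\,\max(H+1,\Gamma_M)^2}{\varepsilon^2}\Big(\log\frac1\delta+S\Big)\log\Big(\frac{e\,SA\,\max(H+1,\Gamma_M)\,(1+\log(1/\delta))}{\varepsilon}\Big).$$ In particular $\tau=\widetilde O\big(\frac{SA((H+1)\vee\Gamma_M)^2}{\varepsilon^2}(\log\frac1\delta+S)\big)$. -/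

import Mathlib

open MeasureTheory ProbabilityTheory Filter Topology

universe u v w

/-- A finite average-reward Markov decision process with state space `S` and action space `A`:
mean rewards `r s a ∈ [0, 1]` and transition probabilities `p s a s'`. -/
structure AMDP (S : Type u) (A : Type v) [Fintype S] where
  r : S → A → ℝ
  p : S → A → S → ℝ
  r_nonneg : ∀ s a, 0 ≤ r s a
  r_le_one : ∀ s a, r s a ≤ 1
  p_nonneg : ∀ s a s', 0 ≤ p s a s'
  p_sum : ∀ s a, ∑ s', p s a s' = 1

namespace AMDP

noncomputable section

section Basic

variable {S : Type u} {A : Type v} [Fintype S] [DecidableEq S]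

/-- Transition matrix of the (stationary, deterministic) policy `π`. -/
def transMat (M : AMDP S A) (π : S → A) : Matrix S S ℝ :=
  Matrix.of fun s s' => M.p s (π s) s'

/-- Mean reward vector of the policy `π`. -/
def rew (M : AMDP S A) (π : S → A) : S → ℝ := fun s => M.r s (π s)

/-- The gain `g_π(s) = lim_T (1/T) E_π[∑_{t<T} r_t | s_0 = s]`; the expected reward at time `t`
is `(P_π ^ t r_π)(s)`. -/
def gain (M : AMDP S A) (π : S → A) (s : S) : ℝ :=
  limUnder atTop fun T : ℕ =>
    (1 / (T : ℝ)) * ∑ t ∈ Finset.range T, ((M.transMat π ^ t).mulVec (M.rew π)) s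

/-- The optimal gain `g⋆`. -/
def optGain (M : AMDP S A) (s : S) : ℝ := ⨆ π : S → A, M.gain π s

/-- `s'` is accessible from `s` in the Markov chain with transition matrix `P`. -/
def Accessible (P : Matrix S S ℝ) (s s' : S) : Prop := ∃ n : ℕ, 0 < (P ^ n) s s'

/-- Recurrence of a state of a finite Markov chain: the chain can return to `s` from every state
that it can reach from `s`. -/
def RecurrentState (P : Matrix S S ℝ) (s : S) : Prop :=
  ∀ s', Accessible P s s' → Accessible P s' s

/-- A finite Markov chain is unichain: it has a single recurrent class and a possibly empty set of
transient states. -/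
def UnichainMat (P : Matrix S S ℝ) : Prop :=
  ∀ s s', RecurrentState P s → RecurrentState P s' → Accessible P s s'

/-- The MDP is unichain: every policy generates a unichain Markov chain. -/
def Unichain (M : AMDP S A) : Prop := ∀ π : S → A, UnichainMat (M.transMat π)

/-- `b` is a bias vector of `π`: it solves the Poisson equation `g_π + (I - P_π) b = r_π`. -/
def IsBias (M : AMDP S A) (π : S → A) (b : S → ℝ) : Prop :=
  ∀ s, M.gain π s + (b s - ((M.transMat π).mulVec b) s) = M.rew π s

/-- `b` is an optimal bias vector: the optimal gain is a constant `g` and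
`g + b(s) = max_a (r(s,a) + p_{s,a} b)` for all `s`. -/
def IsOptBias (M : AMDP S A) (b : S → ℝ) : Prop :=
  ∃ g : ℝ, (∀ s, M.optGain s = g) ∧ ∀ s, g + b s = ⨆ a, (M.r s a + ∑ s', M.p s a s' * b s')

/-- The span `H` of the optimal bias. For a unichain MDP the optimal bias is unique up to an
additive constant, and the set below is a singleton. -/
def biasSpan (M : AMDP S A) : ℝ :=
  sSup {d : ℝ | ∃ b, M.IsOptBias b ∧ d = (⨆ s, b s) - ⨅ s, b s}

/-- The matrix `Π_π`: ones in the column of the reference state `s₀`, and the columns of `I - P_π`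
elsewhere. -/
def poissonMat (M : AMDP S A) (s₀ : S) (π : S → A) : Matrix S S ℝ :=
  Matrix.of fun s s' => if s' = s₀ then 1 else (1 : Matrix S S ℝ) s s' - M.transMat π s s'

/-- Operator norm of a matrix for the sup norm on vectors. -/
def opNorm (B : Matrix S S ℝ) : ℝ :=
  ‖(LinearMap.toContinuousLinearMap B.mulVecLin : (S → ℝ) →L[ℝ] (S → ℝ))‖

/-- The vector `h_π`: gain of `π` in coordinate `s₀`, and `b(s) - b(s₀)` in coordinate `s ≠ s₀`. -/
def hVec (M : AMDP S A) (s₀ : S) (π : S → A) (b : S → ℝ) : S → ℝ :=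
  fun s => if s = s₀ then M.gain π s₀ else b s - b s₀

/-- `δ₁`: the smallest distance to `g⋆` of the gain of a policy that is not optimal. -/
def gap (M : AMDP S A) : ℝ :=
  sInf {d : ℝ | ∃ π : S → A, M.gain π ≠ M.optGain ∧ d = ‖M.gain π - M.optGain‖}

/-- `Δ₁`: the maximum over unichain policies of the norm of `Π_π⁻¹`. -/
def Delta1 (M : AMDP S A) (s₀ : S) : ℝ :=
  sSup {d : ℝ | ∃ π : S → A, UnichainMat (M.transMat π) ∧ d = opNorm (M.poissonMat s₀ π)⁻¹}

/-- `Δ₂`: the maximum over unichain policies of `‖h_π‖_∞`. -/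
def Delta2 (M : AMDP S A) (s₀ : S) : ℝ :=
  sSup {d : ℝ | ∃ π : S → A, UnichainMat (M.transMat π) ∧
    ∃ b, M.IsBias π b ∧ d = ‖M.hVec s₀ π b‖}

/-- `Γ = Δ₁ (Δ₂ + δ₁ / 2)`. -/
def Gam (M : AMDP S A) (s₀ : S) : ℝ := M.Delta1 s₀ * (M.Delta2 s₀ + M.gap / 2)

/-- `max(H + 1, Γ)`. -/
def cplx (M : AMDP S A) (s₀ : S) : ℝ := max (M.biasSpan + 1) (M.Gam s₀)

end Basic

section Algorithm

variable {S : Type u} {A : Type v} [Fintype S] [DecidableEq S]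

/-- Empirical transition probabilities built from `k` next-state samples of each pair; the uniform
vector if `k = 0`. -/
def empProb (y : ℕ → S → A → S) (k : ℕ) (s : S) (a : A) (s' : S) : ℝ :=
  if k = 0 then 1 / (Fintype.card S : ℝ)
  else (((Finset.range k).filter fun i => y i s a = s').card : ℝ) / k

/-- The empirical MDP after `k` samples of each pair: rewards of `M`, empirical transitions. -/
def empMDP (M : AMDP S A) (y : ℕ → S → A → S) (k : ℕ) : AMDP S A where
  r := M.r
  p := empProb y k
  r_nonneg := M.r_nonneg
  r_le_one := M.r_le_one
  p_nonneg s a s' := by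
    unfold empProb
    split_ifs <;> positivity
  p_sum s a := by
    unfold empProb
    split_ifs with hk
    · have : (Fintype.card S : ℝ) ≠ 0 := by
        have : 0 < Fintype.card S := Fintype.card_pos_iff.mpr ⟨s⟩
        positivity
      simp [this]
    · have hk' : (k : ℝ) ≠ 0 := by exact_mod_cast hk
      rw [← Finset.sum_div, ← Nat.cast_sum,
        ← Finset.card_eq_sum_card_fiberwise (s := Finset.range k) (t := Finset.univ)
          (f := fun i => y i s a) (fun _ _ => by simp)]
      simp [hk']

/-- Kullback-Leibler divergence of two probability vectors. -/
def kl (p q : S → ℝ) : EReal :=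
  open Classical in
  if ∀ s, q s = 0 → p s = 0 then ((∑ s, p s * Real.log (p s / q s) : ℝ) : EReal) else ⊤

variable (S A) in
/-- The threshold `x(δ, n) = log(SA/δ) + (S-1) log(e (1 + n/(S-1)))`. -/
def thr [Fintype A] (δ : ℝ) (n : ℕ) : ℝ :=
  Real.log ((Fintype.card S * Fintype.card A : ℝ) / δ)
    + ((Fintype.card S : ℝ) - 1)
      * Real.log (Real.exp 1 * (1 + (n : ℝ) / ((Fintype.card S : ℝ) - 1)))

variable [Fintype A]

variable (A) in
/-- The values `p' b` for `p'` in the KL confidence region around `phat` after `n` samples. -/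
def klValues (δ : ℝ) (n : ℕ) (phat b : S → ℝ) : Set ℝ :=
  {z | ∃ q ∈ stdSimplex ℝ S, ((n : ℝ) : EReal) * kl phat q ≤ ((thr S A δ n : ℝ) : EReal) ∧
    z = ∑ s', q s' * b s'}

/-- The two versions of the confidence bounds used by the stopping rule. -/
inductive BoundKind
  | kl
  | relaxed

variable (A) in
/-- Upper confidence bound on `p_{s,a} b`: `U` (KL version) or its relaxation. -/
def upperB (kind : BoundKind) (δ : ℝ) (n : ℕ) (phat b : S → ℝ) : ℝ :=
  match kind with
  | .kl => sSup (klValues A δ n phat b)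
  | .relaxed => ∑ s', phat s' * b s' + ‖b‖ * √(2 * thr S A δ n / n)

variable (A) in
/-- Lower confidence bound on `p_{s,a} b`: `L` (KL version) or its relaxation. -/
def lowerB (kind : BoundKind) (δ : ℝ) (n : ℕ) (phat b : S → ℝ) : ℝ :=
  match kind with
  | .kl => sInf (klValues A δ n phat b)
  | .relaxed => ∑ s', phat s' * b s' - ‖b‖ * √(2 * thr S A δ n / n)

/-- The stopping condition after `k` samples of each pair, with the vector `b`:
`max_s max_a I♯_{s,a}(b) - min_s max_a I♭_{s,a}(b) ≤ ε`. -/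
def StopCond (M : AMDP S A) (kind : BoundKind) (ε δ : ℝ) (y : ℕ → S → A → S) (k : ℕ)
    (b : S → ℝ) : Prop :=
  (⨆ s, ⨆ a, (M.r s a + upperB A kind δ k (empProb y k s a) b - b s))
    - (⨅ s, ⨆ a, (M.r s a + lowerB A kind δ k (empProb y k s a) b - b s)) ≤ ε

/-- A routine that returns, for every MDP that has an optimal bias vector, the one that vanishes
at the reference state `s₀` (no requirement on the other MDPs). -/
def IsBiasRoutine (s₀ : S) (β : AMDP S A → S → ℝ) : Prop :=
  ∀ M : AMDP S A, (∃ b, M.IsOptBias b) → M.IsOptBias (β M) ∧ β M s₀ = 0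

/-- Number of samples `τ` used by the algorithm on the samples `y`: in round `k = 1, 2, …` every
pair is sampled once, and the algorithm stops after the first round at which the stopping
condition holds for the bias of the empirical MDP. The value is `⊤` if it never stops. -/
def sampleComplexity (M : AMDP S A) (kind : BoundKind) (ε δ : ℝ) (β : AMDP S A → S → ℝ)
    (y : ℕ → S → A → S) : ℕ∞ :=
  sInf {t : ℕ∞ | ∃ k : ℕ, 1 ≤ k ∧ M.StopCond kind ε δ y k (β (M.empMDP y k)) ∧
    t = ((k * (Fintype.card S * Fintype.card A) : ℕ) : ℕ∞)}

/-- `X k s a` is the `k`-th next state drawn by the generative model of `M` from `(s, a)`: all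
draws are independent, and `X k s a` has law `p_{s,a}`. -/
structure IsGenerativeModel (M : AMDP S A) [MeasurableSpace S] {Ω : Type w} [MeasurableSpace Ω]
    (μ : Measure Ω) (X : ℕ → S → A → Ω → S) : Prop where
  meas : ∀ k s a, Measurable (X k s a)
  indep : iIndepFun (fun i : ℕ × S × A => X i.1 i.2.1 i.2.2) μ
  law : ∀ k s a s', μ (X k s a ⁻¹' {s'}) = ENNReal.ofReal (M.p s a s')

variable (S A) in
/-- `y = 1 + ln(SA/δ) / (S-1)`. -/
def yConst (δ : ℝ) : ℝ :=
  1 + Real.log ((Fintype.card S * Fintype.card A : ℝ) / δ) / ((Fintype.card S : ℝ) - 1)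

/-- `C = (1/288) min(δ₁, ε)² / max(H+1, Γ)²`. -/
def CConst (M : AMDP S A) (s₀ : S) (ε : ℝ) : ℝ :=
  1 / 288 * (min M.gap ε ^ 2 / M.cplx s₀ ^ 2)

/-- `SA (S-1) (y/C) (1 + (2/y) log((y+2)/C))`. -/
def explicitBound (M : AMDP S A) (s₀ : S) (ε δ : ℝ) : ℝ :=
  (Fintype.card S : ℝ) * Fintype.card A * ((Fintype.card S : ℝ) - 1)
    * (yConst S A δ / M.CConst s₀ ε)
    * (1 + 2 / yConst S A δ * Real.log ((yConst S A δ + 2) / M.CConst s₀ ε))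

/-- `(SA max(H+1, Γ)² / ε²) (log(1/δ) + S)`. -/
def mainRate (M : AMDP S A) (s₀ : S) (ε δ : ℝ) : ℝ :=
  (Fintype.card S : ℝ) * Fintype.card A * M.cplx s₀ ^ 2 / ε ^ 2
    * (Real.log (1 / δ) + Fintype.card S)

/-- The logarithmic factor `log(e S A max(H+1, Γ) (1 + log(1/δ)) / ε)`. -/
def logFactor (M : AMDP S A) (s₀ : S) (ε δ : ℝ) : ℝ :=
  Real.log (Real.exp 1 * Fintype.card S * Fintype.card A * M.cplx s₀
    * (1 + Real.log (1 / δ)) / ε)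

end Algorithm

end

end AMDP

/-! The whole argument takes place at one deterministic round `k`, chosen with x(δ,k) ≤ C k and k
just below the explicit bound (`exists_round`). It suffices that, with probability at least 1 - δ,
the stopping condition holds at that round.

With this probability every empirical distribution lies in its KL region
(`IsGenerativeModel.le_measure_kl_le`), and by Pinsker (`sum_abs_sub_le_sqrt`) it is then within η =
√(2x/k) ≤ min(δ₁,ε) / (12 max(H+1,Γ)) of the true one in ℓ¹. Such a perturbation does not spoil the
Poisson equations. In a unichain MDP each Π_π is invertible, because harmonic functions are
constant. Since Δ₁η ≤ 1/6, the perturbed matrices stay invertible and the solutions at most double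
in norm (`norm_le_of_perturbation`). The empirical chains need not be unichain: invertibility for
all policies is enough to solve the optimality equation, by letting the discount tend to 1
(`exists_optimality_solution`). So the routine returns a true optimal bias b, which solves the
Poisson equation of an empirically greedy policy, whence ‖b‖ ≤ 2Δ₂ ≤ 2Γ. At such a b the quantity
max_a (r + p̂b - b(s)) is the same in all states, so the stopping gap is at most 2‖b‖η ≤ ε
(`stopCond_of_isOptBias`).

Concentration uses the method of mixtures. The likelihood ratio between the uniform mixture over the
simplex and the true law is a nonnegative supermartingale started at 1, so Ville's inequality
controls it at all times at once. The maximum likelihood exceeds the mixture by at most the binomial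
coefficient of n+S-1 over S-1, which is the source of the second term of x. The second claim is a
majorisation of the explicit bound. -/

namespace AMDP

/-! ### Finite Markov chains: recurrence, harmonic functions, maximum principle -/

section Chains

variable {S : Type u} [Fintype S] [DecidableEq S] {P : Matrix S S ℝ}

lemma Accessible.refl (P : Matrix S S ℝ) (s : S) : Accessible P s s := ⟨0, by simp⟩

lemma Accessible.trans (hP : P ∈ Matrix.rowStochastic ℝ S) {s t u : S}
    (h₁ : Accessible P s t) (h₂ : Accessible P t u) : Accessible P s u := by
  obtain ⟨m, hm⟩ := h₁
  obtain ⟨n, hn⟩ := h₂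
  refine ⟨m + n, ?_⟩
  rw [pow_add, Matrix.mul_apply]
  refine (mul_pos hm hn).trans_le
    (Finset.single_le_sum (f := fun t => (P ^ m) s t * (P ^ n) t u) (fun i _ => ?_)
      (Finset.mem_univ t))
  exact mul_nonneg (Matrix.nonneg_of_mem_rowStochastic (pow_mem hP m))
    (Matrix.nonneg_of_mem_rowStochastic (pow_mem hP n))

/-- A finite Markov chain can reach a recurrent state from every state. -/
lemma exists_recurrentState (hP : P ∈ Matrix.rowStochastic ℝ S) (s : S) :
    ∃ t, Accessible P s t ∧ RecurrentState P t := by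
  classical
  -- Among the states reachable from `s`, take one with the fewest accessible states. A state `u`
  -- reached from it sees no more states than it does, hence by minimality the same ones, including
  -- `t`.
  obtain ⟨t, ht, hmin⟩ := Finset.exists_min_image (Finset.univ.filter (Accessible P s))
    (fun t => (Finset.univ.filter (Accessible P t)).card) ⟨s, by simp [Accessible.refl]⟩
  simp only [Finset.mem_filter, Finset.mem_univ, true_and] at ht hmin
  refine ⟨t, ht, fun u hu => ?_⟩
  have hsub : Finset.univ.filter (Accessible P u) ⊆ Finset.univ.filter (Accessible P t) := by
    intro x hx
    simp only [Finset.mem_filter, Finset.mem_univ, true_and] at hx ⊢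
    exact hu.trans hP hx
  have heq := Finset.eq_of_subset_of_card_le hsub (hmin u (ht.trans hP hu))
  have : t ∈ Finset.univ.filter (Accessible P t) := by simp [Accessible.refl]
  rw [← heq] at this
  simpa using this

lemma pow_mulVec_of_harmonic {w : S → ℝ} (hw : P.mulVec w = w) (n : ℕ) :
    (P ^ n).mulVec w = w := by
  induction n with
  | zero => simp
  | succ n ih => rw [pow_succ, ← Matrix.mulVec_mulVec, hw, ih]

/-- At a maximum of `w`, the average of the nonnegative defects `w s - w u` under `P ^ n` is zero,
so the defect vanishes wherever the weight is positive. -/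
lemma eq_of_accessible_of_harmonic (hP : P ∈ Matrix.rowStochastic ℝ S) {w : S → ℝ}
    (hw : P.mulVec w = w) {s t : S} (hs : ∀ u, w u ≤ w s) (hst : Accessible P s t) :
    w t = w s := by
  obtain ⟨n, hn⟩ := hst
  have hPn := pow_mem hP n
  have h0 : ∑ u, (P ^ n) s u * (w s - w u) = 0 := by
    have h1 : ∑ u, (P ^ n) s u * w u = w s := congrFun (pow_mulVec_of_harmonic hw n) s
    simp only [mul_sub, Finset.sum_sub_distrib, h1, ← Finset.sum_mul,
      Matrix.sum_row_of_mem_rowStochastic hPn]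
    ring
  have h2 := (Finset.sum_eq_zero_iff_of_nonneg (fun u _ =>
    mul_nonneg (Matrix.nonneg_of_mem_rowStochastic hPn) (sub_nonneg.mpr (hs u)))).mp h0 t
    (Finset.mem_univ t)
  rcases mul_eq_zero.mp h2 with h | h
  · exact absurd h hn.ne'
  · linarith

/-- A harmonic function of a unichain Markov chain is constant. -/
lemma UnichainMat.eq_of_harmonic (hP : P ∈ Matrix.rowStochastic ℝ S) (hu : UnichainMat P)
    {w : S → ℝ} (hw : P.mulVec w = w) (s t : S) : w s = w t := by
  have : Nonempty S := ⟨s⟩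
  obtain ⟨m₁, hm₁⟩ := Finite.exists_max w
  obtain ⟨m₂, hm₂⟩ := Finite.exists_min w
  -- The maximum propagates from `m₁` into the single recurrent class and the minimum propagates
  -- from `m₂` into the same class, so both values are taken at `r₂`.
  obtain ⟨r₁, ha₁, hr₁⟩ := exists_recurrentState hP m₁
  obtain ⟨r₂, ha₂, hr₂⟩ := exists_recurrentState hP m₂
  have e₁ : w r₂ = w m₁ :=
    eq_of_accessible_of_harmonic hP hw hm₁ (ha₁.trans hP (hu r₁ r₂ hr₁ hr₂))
  have e₂ : (-w) r₂ = (-w) m₂ :=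
    eq_of_accessible_of_harmonic hP (by rw [Matrix.mulVec_neg, hw])
      (fun u => neg_le_neg (hm₂ u)) ha₂
  simp only [Pi.neg_apply] at e₂
  linarith [hm₁ s, hm₁ t, hm₂ s, hm₂ t]

lemma mulVec_le_of_forall_le (hP : P ∈ Matrix.rowStochastic ℝ S) {w : S → ℝ} {c : ℝ}
    (hw : ∀ u, w u ≤ c) (s : S) : (P.mulVec w) s ≤ c := by
  calc (P.mulVec w) s = ∑ u, P s u * w u := rfl
    _ ≤ ∑ u, P s u * c := Finset.sum_le_sum fun u _ =>
        mul_le_mul_of_nonneg_left (hw u) (Matrix.nonneg_of_mem_rowStochastic hP)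
    _ = c := by rw [← Finset.sum_mul, Matrix.sum_row_of_mem_rowStochastic hP, one_mul]

lemma abs_mulVec_le (hP : P ∈ Matrix.rowStochastic ℝ S) (w : S → ℝ) (s : S) :
    |(P.mulVec w) s| ≤ ‖w‖ := by
  rw [abs_le]
  constructor
  · have := mulVec_le_of_forall_le hP (w := -w) (c := ‖w‖)
      (fun u => (neg_le_abs _).trans (norm_le_pi_norm w u)) s
    rw [Matrix.mulVec_neg, Pi.neg_apply] at this
    linarith
  · exact mulVec_le_of_forall_le hP (fun u => (le_abs_self _).trans (norm_le_pi_norm w u)) s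

/-- Maximum principle. -/
lemma le_of_add_le_mulVec [Nonempty S] (hP : P ∈ Matrix.rowStochastic ℝ S) {w : S → ℝ} {g c : ℝ}
    (h : ∀ s, g + w s ≤ c + (P.mulVec w) s) : g ≤ c := by
  obtain ⟨m, hm⟩ := Finite.exists_max w
  linarith [h m, mulVec_le_of_forall_le hP hm m]

lemma mulVec_sub_const (hP : P ∈ Matrix.rowStochastic ℝ S) (w : S → ℝ) (c : ℝ) (s : S) :
    (P.mulVec fun u => w u - c) s = (P.mulVec w) s - c := by
  change ∑ u, P s u * (w u - c) = ∑ u, P s u * w u - c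
  simp only [mul_sub, Finset.sum_sub_distrib, ← Finset.sum_mul,
    Matrix.sum_row_of_mem_rowStochastic hP, one_mul]

lemma abs_mulVec_sub_mulVec_le {P Q : Matrix S S ℝ} {η : ℝ} (s : S)
    (h : ∑ u, |P s u - Q s u| ≤ η) (w : S → ℝ) :
    |(P.mulVec w) s - (Q.mulVec w) s| ≤ η * ‖w‖ := by
  have : (P.mulVec w) s - (Q.mulVec w) s = ∑ u, (P s u - Q s u) * w u := by
    change ∑ u, P s u * w u - ∑ u, Q s u * w u = _
    rw [← Finset.sum_sub_distrib]
    exact Finset.sum_congr rfl fun u _ => by ring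
  rw [this]
  calc |∑ u, (P s u - Q s u) * w u| ≤ ∑ u, |(P s u - Q s u) * w u| :=
        Finset.abs_sum_le_sum_abs _ _
    _ ≤ ∑ u, |P s u - Q s u| * ‖w‖ := Finset.sum_le_sum fun u _ => by
        rw [abs_mul]
        exact mul_le_mul_of_nonneg_left (norm_le_pi_norm w u) (abs_nonneg _)
    _ ≤ η * ‖w‖ := by
        rw [← Finset.sum_mul]
        exact mul_le_mul_of_nonneg_right h (norm_nonneg _)

end Chains

/-! ### Poisson equation, gain and the matrix Π_π -/

section Poisson

variable {S : Type u} {A : Type v} [Fintype S] [DecidableEq S] (M : AMDP S A) (s₀ : S)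
  (π : S → A)

lemma transMat_mem_rowStochastic : M.transMat π ∈ Matrix.rowStochastic ℝ S :=
  Matrix.mem_rowStochastic_iff_sum.mpr ⟨fun _ _ => M.p_nonneg _ _ _, fun _ => M.p_sum _ _⟩

lemma poissonMat_mulVec (h : S → ℝ) (s : S) :
    ((M.poissonMat s₀ π).mulVec h) s = h s₀ + (Function.update h s₀ 0 s
      - ((M.transMat π).mulVec (Function.update h s₀ 0)) s) := by
  have h1 : ∀ u, M.poissonMat s₀ π s u * h u = (if u = s₀ then h s₀ else 0)
      + ((1 : Matrix S S ℝ) s u * Function.update h s₀ 0 u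
        - M.transMat π s u * Function.update h s₀ 0 u) := by
    intro u
    by_cases hu : u = s₀
    · subst hu
      simp [poissonMat]
    · simp [poissonMat, hu, sub_mul]
  change ∑ u, M.poissonMat s₀ π s u * h u = _
  rw [Finset.sum_congr rfl fun u _ => h1 u, Finset.sum_add_distrib, Finset.sum_sub_distrib,
    Finset.sum_ite_eq' Finset.univ s₀, if_pos (Finset.mem_univ s₀)]
  congr 2
  exact congrFun (Matrix.one_mulVec (Function.update h s₀ 0)) s

variable {M s₀ π}

/-- A kernel vector is a Poisson solution with zero reward. The maximum principle for `w` and `-w`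
makes its gain zero, so `w` is harmonic, hence constant, and it vanishes at `s₀`. -/
lemma poissonMat_isUnit_of_unichainMat (hu : UnichainMat (M.transMat π)) :
    IsUnit (M.poissonMat s₀ π) := by
  have : Nonempty S := ⟨s₀⟩
  have hP := M.transMat_mem_rowStochastic π
  rw [← Matrix.mulVec_injective_iff_isUnit]
  refine (injective_iff_map_eq_zero (M.poissonMat s₀ π).mulVecLin).mpr fun h hh => ?_
  set w := Function.update h s₀ 0 with hw
  have key : ∀ s, h s₀ + (w s - ((M.transMat π).mulVec w) s) = 0 := fun s => by
    rw [← M.poissonMat_mulVec s₀ π h s]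
    exact congrFun hh s
  have h1 : h s₀ ≤ 0 := le_of_add_le_mulVec hP (w := w) fun s => by linarith [key s]
  have h2 : -h s₀ ≤ 0 := le_of_add_le_mulVec hP (w := -w) fun s => by
    rw [Matrix.mulVec_neg, Pi.neg_apply, Pi.neg_apply]
    linarith [key s]
  have h0 : h s₀ = 0 := by linarith
  have hharm : (M.transMat π).mulVec w = w := by
    funext s
    linarith [key s]
  funext s
  by_cases hs : s = s₀
  · rw [hs]
    exact h0
  · have := hu.eq_of_harmonic hP hharm s s₀
    rw [hw, Function.update_self, Function.update_of_ne hs] at this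
    exact this

/-- The rewards telescope along the powers of the transition matrix, leaving a boundary term of size
at most 2‖b‖/T. No structure of the chain is needed. -/
lemma gain_eq_of_poisson {b : S → ℝ} {g : ℝ}
    (h : ∀ s, g + (b s - ((M.transMat π).mulVec b) s) = M.rew π s) (s : S) :
    M.gain π s = g := by
  have hP := M.transMat_mem_rowStochastic π
  have hr : M.rew π = (fun _ => g) + (b - (M.transMat π).mulVec b) := by
    funext s
    exact (h s).symm
  have hstep : ∀ t : ℕ, ((M.transMat π ^ t).mulVec (M.rew π)) s
      = g + (((M.transMat π ^ t).mulVec b) s - ((M.transMat π ^ (t + 1)).mulVec b) s) := by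
    intro t
    have hc : (M.transMat π ^ t).mulVec (fun _ => g) = fun _ => g := by
      have := Matrix.one_vecMul_of_mem_rowStochastic (pow_mem hP t)
      have h2 : (fun _ : S => g) = g • (1 : S → ℝ) := by
        funext
        simp
      rw [h2, Matrix.mulVec_smul, this]
    rw [hr, Matrix.mulVec_add, hc, Matrix.mulVec_sub, Matrix.mulVec_mulVec, ← pow_succ]
    rfl
  have hsum : ∀ T : ℕ, ∑ t ∈ Finset.range T, ((M.transMat π ^ t).mulVec (M.rew π)) s
      = T * g + (b s - ((M.transMat π ^ T).mulVec b) s) := by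
    intro T
    simp only [hstep, Finset.sum_add_distrib,
      Finset.sum_range_sub' fun t => ((M.transMat π ^ t).mulVec b) s]
    simp
  refine Tendsto.limUnder_eq ?_
  rw [tendsto_iff_norm_sub_tendsto_zero]
  have hlim : Tendsto (fun T : ℕ => (2 * ‖b‖) / (T : ℝ)) atTop (𝓝 0) :=
    tendsto_const_div_atTop_nhds_zero_nat _
  refine squeeze_zero' (Eventually.of_forall fun _ => norm_nonneg _) ?_ hlim
  filter_upwards [eventually_gt_atTop 0] with T hT
  have hT' : (0 : ℝ) < T := by exact_mod_cast hT
  rw [hsum, show 1 / (T : ℝ) * (T * g + (b s - ((M.transMat π ^ T).mulVec b) s)) - g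
    = (b s - ((M.transMat π ^ T).mulVec b) s) / T by field_simp; ring, norm_div,
    Real.norm_of_nonneg hT'.le]
  refine div_le_div_of_nonneg_right ?_ hT'.le
  have h1 := abs_mulVec_le (pow_mem hP T) b s
  have h2 := norm_le_pi_norm b s
  calc ‖b s - ((M.transMat π ^ T).mulVec b) s‖
      ≤ ‖b s‖ + ‖((M.transMat π ^ T).mulVec b) s‖ := norm_sub_le _ _
    _ ≤ 2 * ‖b‖ := by rw [Real.norm_eq_abs ((M.transMat π ^ T).mulVec b s)]; linarith

lemma poisson_of_poissonMat_mulVec {h : S → ℝ} (hh : (M.poissonMat s₀ π).mulVec h = M.rew π)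
    (s : S) : h s₀ + (Function.update h s₀ 0 s
      - ((M.transMat π).mulVec (Function.update h s₀ 0)) s) = M.rew π s := by
  rw [← M.poissonMat_mulVec s₀ π h s, hh]

lemma gain_eq_of_poissonMat_mulVec {h : S → ℝ}
    (hh : (M.poissonMat s₀ π).mulVec h = M.rew π) (s : S) : M.gain π s = h s₀ :=
  gain_eq_of_poisson (poisson_of_poissonMat_mulVec hh) s

lemma mulVec_inv_mulVec (hU : IsUnit (M.poissonMat s₀ π)) (v : S → ℝ) :
    (M.poissonMat s₀ π).mulVec ((M.poissonMat s₀ π)⁻¹.mulVec v) = v := by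
  rw [Matrix.mulVec_mulVec, Matrix.mul_nonsing_inv _ ((Matrix.isUnit_iff_isUnit_det _).mp hU),
    Matrix.one_mulVec]

lemma inv_mulVec_mulVec (hU : IsUnit (M.poissonMat s₀ π)) (v : S → ℝ) :
    (M.poissonMat s₀ π)⁻¹.mulVec ((M.poissonMat s₀ π).mulVec v) = v := by
  rw [Matrix.mulVec_mulVec, Matrix.nonsing_inv_mul _ ((Matrix.isUnit_iff_isUnit_det _).mp hU),
    Matrix.one_mulVec]

/-- A bias is defined with a gain that may depend on the state, whereas `hVec` keeps only its value
at `s₀`. Invertibility makes the gain constant, which reconciles the two. -/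
lemma poissonMat_mulVec_hVec (hU : IsUnit (M.poissonMat s₀ π)) {b : S → ℝ}
    (hb : M.IsBias π b) : (M.poissonMat s₀ π).mulVec (M.hVec s₀ π b) = M.rew π := by
  have hg := gain_eq_of_poissonMat_mulVec (mulVec_inv_mulVec hU (M.rew π))
  have hup : Function.update (M.hVec s₀ π b) s₀ 0 = fun s => b s - b s₀ := by
    funext s
    by_cases hs : s = s₀
    · simp [hs]
    · simp [hs, hVec]
  funext s
  rw [poissonMat_mulVec, hup, mulVec_sub_const (M.transMat_mem_rowStochastic π), ← hb s, hg s]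
  simp only [hVec, if_true, hg s₀]
  ring

lemma isBias_of_poissonMat_mulVec {h : S → ℝ}
    (hh : (M.poissonMat s₀ π).mulVec h = M.rew π) : M.IsBias π (Function.update h s₀ 0) := by
  intro s
  rw [gain_eq_of_poissonMat_mulVec hh]
  exact poisson_of_poissonMat_mulVec hh s

lemma hVec_of_poissonMat_mulVec {h : S → ℝ}
    (hh : (M.poissonMat s₀ π).mulVec h = M.rew π) :
    M.hVec s₀ π (Function.update h s₀ 0) = h := by
  funext s
  by_cases hs : s = s₀
  · simp [hVec, hs, gain_eq_of_poissonMat_mulVec hh]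
  · simp [hVec, hs]

end Poisson

/-! ### Complexity constants and perturbation of the Poisson equations -/

section Constants

variable {S : Type u} {A : Type v} [Fintype S] [DecidableEq S]

lemma norm_mulVec_le_opNorm (B : Matrix S S ℝ) (v : S → ℝ) :
    ‖B.mulVec v‖ ≤ opNorm B * ‖v‖ :=
  (LinearMap.toContinuousLinearMap B.mulVecLin).le_opNorm v

variable [Finite A] {M : AMDP S A} {s₀ : S}

lemma opNorm_inv_le_Delta1 {π : S → A} (hu : UnichainMat (M.transMat π)) :
    opNorm (M.poissonMat s₀ π)⁻¹ ≤ M.Delta1 s₀ := by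
  refine le_csSup (Set.Finite.bddAbove ?_) ⟨π, hu, rfl⟩
  refine (Set.finite_range fun π => opNorm (M.poissonMat s₀ π)⁻¹).subset ?_
  rintro d ⟨π, -, rfl⟩
  exact ⟨π, rfl⟩

lemma norm_le_Delta2 {π : S → A} (hu : UnichainMat (M.transMat π)) {h : S → ℝ}
    (hh : (M.poissonMat s₀ π).mulVec h = M.rew π) : ‖h‖ ≤ M.Delta2 s₀ := by
  refine le_csSup (Set.Finite.bddAbove ?_) ⟨π, hu, _, isBias_of_poissonMat_mulVec hh, by
    rw [hVec_of_poissonMat_mulVec hh]⟩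
  -- The supremum runs over all biases of each policy, but invertibility leaves a single `hVec` per
  -- policy. The set is thus finite, and its real supremum is not the default value.
  refine (Set.finite_range fun π => ‖(M.poissonMat s₀ π)⁻¹.mulVec (M.rew π)‖).subset ?_
  rintro d ⟨π, hπ, b, hb, rfl⟩
  have hU : IsUnit (M.poissonMat s₀ π) := poissonMat_isUnit_of_unichainMat hπ
  refine ⟨π, ?_⟩
  simp only [← poissonMat_mulVec_hVec hU hb, inv_mulVec_mulVec hU]

/-- Π_π sends the basis vector at `s₀` to the all-ones vector, and both have sup norm 1. This is
what makes Δ₂ ≤ Γ. -/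
lemma one_le_Delta1 {π : S → A} (hu : UnichainMat (M.transMat π)) : 1 ≤ M.Delta1 s₀ := by
  have hU : IsUnit (M.poissonMat s₀ π) := poissonMat_isUnit_of_unichainMat hu
  refine le_trans ?_ (opNorm_inv_le_Delta1 (s₀ := s₀) hu)
  have : Nonempty S := ⟨s₀⟩
  have h1 : (M.poissonMat s₀ π).mulVec (Pi.single s₀ 1) = 1 := by
    funext s
    simp [poissonMat]
  have h2 := norm_mulVec_le_opNorm (M.poissonMat s₀ π)⁻¹ 1
  rw [← h1, inv_mulVec_mulVec hU, h1] at h2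
  have h3 := norm_le_pi_norm (Pi.single s₀ 1 : S → ℝ) s₀
  simp only [Pi.single_eq_same, norm_one] at h2 h3
  linarith

lemma Delta2_nonneg : 0 ≤ M.Delta2 s₀ :=
  Real.sSup_nonneg (by rintro d ⟨π, -, b, -, rfl⟩; exact norm_nonneg _)

lemma gap_mem (hne : ∃ π : S → A, M.gain π ≠ M.optGain) :
    ∃ π : S → A, M.gain π ≠ M.optGain ∧ M.gap = ‖M.gain π - M.optGain‖ := by
  obtain ⟨π, hπ⟩ := hne
  refine Set.Nonempty.csInf_mem (s := {d : ℝ | ∃ π : S → A, M.gain π ≠ M.optGain ∧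
    d = ‖M.gain π - M.optGain‖}) ⟨_, π, hπ, rfl⟩ ?_
  refine (Set.finite_range fun π => ‖M.gain π - M.optGain‖).subset ?_
  rintro d ⟨π, -, rfl⟩
  exact ⟨π, rfl⟩

lemma gap_pos (hne : ∃ π : S → A, M.gain π ≠ M.optGain) : 0 < M.gap := by
  obtain ⟨π, hπ, h⟩ := gap_mem hne
  rw [h]
  exact norm_pos_iff.mpr (sub_ne_zero.mpr hπ)

lemma one_le_cplx : 1 ≤ M.cplx s₀ := by
  refine le_trans ?_ (le_max_left _ _)
  have : 0 ≤ M.biasSpan := by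
    refine Real.sSup_nonneg ?_
    rintro d ⟨b, -, rfl⟩
    have : Nonempty S := ⟨s₀⟩
    exact sub_nonneg.mpr (ciInf_le_ciSup (Set.finite_range b).bddBelow
      (Set.finite_range b).bddAbove)
  linarith

/-- Solutions of the Poisson equations of a perturbed MDP are controlled by those of `M`. -/
lemma norm_le_of_perturbation {M' : AMDP S A} (hu : M.Unichain) {η : ℝ}
    (hgap : 0 < M.gap) (hη0 : 0 ≤ η) (hη : M.Gam s₀ * η ≤ M.gap / 12)
    (hpp : ∀ s a, ∑ s', |M.p s a s' - M'.p s a s'| ≤ η) (π : S → A) {v h : S → ℝ}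
    (hvh : (M'.poissonMat s₀ π).mulVec v = (M.poissonMat s₀ π).mulVec h) :
    ‖v‖ ≤ 2 * ‖h‖ := by
  have hU : IsUnit (M.poissonMat s₀ π) := poissonMat_isUnit_of_unichainMat (hu π)
  have hΔ := one_le_Delta1 (s₀ := s₀) (hu π)
  have hΔ2 : 0 ≤ M.Delta2 s₀ := Delta2_nonneg
  -- By hypothesis Π(v - h) = (Π - Π')v. The columns at `s₀` agree, so only the difference of the
  -- transition matrices acts, on `v` with its `s₀` coordinate set to zero.
  have hdiff : ‖(M.poissonMat s₀ π).mulVec (v - h)‖ ≤ η * ‖v‖ := by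
    refine (pi_norm_le_iff_of_nonneg (by positivity)).mpr fun s => ?_
    rw [Matrix.mulVec_sub, ← hvh, Pi.sub_apply, poissonMat_mulVec, poissonMat_mulVec]
    set w := Function.update v s₀ 0 with hw
    have hwv : ‖w‖ ≤ ‖v‖ := by
      refine (pi_norm_le_iff_of_nonneg (norm_nonneg _)).mpr fun t => ?_
      by_cases ht : t = s₀
      · simp [hw, ht]
      · rw [hw, Function.update_of_ne ht]
        exact norm_le_pi_norm v t
    have h1 := abs_mulVec_sub_mulVec_le (P := M.transMat π) (Q := M'.transMat π) s
      (hpp s (π s)) w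
    calc _ = |(M.transMat π).mulVec w s - (M'.transMat π).mulVec w s| := by
          rw [Real.norm_eq_abs, abs_sub_comm]
          congr 1
          ring
      _ ≤ η * ‖w‖ := h1
      _ ≤ η * ‖v‖ := mul_le_mul_of_nonneg_left hwv hη0
  have h2 : ‖v - h‖ ≤ M.Delta1 s₀ * (η * ‖v‖) := by
    calc ‖v - h‖ = ‖(M.poissonMat s₀ π)⁻¹.mulVec ((M.poissonMat s₀ π).mulVec (v - h))‖ := by
          rw [inv_mulVec_mulVec hU]
      _ ≤ opNorm (M.poissonMat s₀ π)⁻¹ * ‖(M.poissonMat s₀ π).mulVec (v - h)‖ :=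
          norm_mulVec_le_opNorm _ _
      _ ≤ M.Delta1 s₀ * (η * ‖v‖) :=
          mul_le_mul (opNorm_inv_le_Delta1 (hu π)) hdiff (norm_nonneg _) (by linarith)
  -- From Γ ≥ Δ₁δ₁/2 and Γη ≤ δ₁/12. Then ‖v‖ ≤ ‖h‖ + ‖v‖/6, which is better than the factor 2
  -- claimed.
  have h3 : M.Delta1 s₀ * η ≤ 1 / 6 := by
    have h4 : M.Delta1 s₀ * η * (M.gap / 2) ≤ M.gap / 12 := by
      refine le_trans ?_ hη
      have : 0 ≤ M.Delta1 s₀ * η * M.Delta2 s₀ := by positivity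
      unfold Gam
      nlinarith
    by_contra hcon
    push Not at hcon
    nlinarith
  have h5 : ‖v‖ ≤ ‖h‖ + ‖v - h‖ := by
    have := norm_add_le h (v - h)
    rwa [add_sub_cancel] at this
  nlinarith [norm_nonneg v, mul_le_mul_of_nonneg_right h3 (norm_nonneg v)]

lemma poissonMat_isUnit_of_perturbation {M' : AMDP S A} (hu : M.Unichain) {η : ℝ}
    (hgap : 0 < M.gap) (hη0 : 0 ≤ η) (hη : M.Gam s₀ * η ≤ M.gap / 12)
    (hpp : ∀ s a, ∑ s', |M.p s a s' - M'.p s a s'| ≤ η) (π : S → A) :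
    IsUnit (M'.poissonMat s₀ π) := by
  rw [← Matrix.mulVec_injective_iff_isUnit]
  refine (injective_iff_map_eq_zero (M'.poissonMat s₀ π).mulVecLin).mpr fun v hv => ?_
  have := norm_le_of_perturbation (h := 0) hu hgap hη0 hη hpp π (hv.trans (by simp))
  simpa using this

end Constants

end AMDP

namespace AMDP

/-! ### Existence and size of the optimal bias, by vanishing discount -/

section OptimalBias

variable {S : Type u} {A : Type v} [Fintype S] [DecidableEq S] [Finite A] [Nonempty A]
  {M : AMDP S A} {s₀ : S}

lemma abs_ciSup_sub_ciSup_le {f g : A → ℝ} {c : ℝ} (h : ∀ a, |f a - g a| ≤ c) :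
    |(⨆ a, f a) - ⨆ a, g a| ≤ c := by
  obtain ⟨a, ha⟩ := exists_eq_ciSup_of_finite (f := f)
  obtain ⟨a', ha'⟩ := exists_eq_ciSup_of_finite (f := g)
  have h1 := le_ciSup (Set.finite_range g).bddAbove a
  have h2 := le_ciSup (Set.finite_range f).bddAbove a'
  have h3 := abs_le.mp (h a)
  have h4 := abs_le.mp (h a')
  rw [abs_le]
  constructor <;> linarith [h3.1, h3.2, h4.1, h4.2]

/-- The discounted Bellman equation has a solution. -/
lemma exists_discounted_value (M : AMDP S A) {l : ℝ} (h0 : 0 ≤ l) (h1 : l < 1) :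
    ∃ V : S → ℝ, ∀ s, V s = ⨆ a, (M.r s a + l * ∑ s', M.p s a s' * V s') := by
  let T : (S → ℝ) → S → ℝ := fun V s => ⨆ a, (M.r s a + l * ∑ s', M.p s a s' * V s')
  have hT : ContractingWith ⟨l, h0⟩ T := by
    refine ⟨h1, LipschitzWith.of_dist_le_mul fun V W => ?_⟩
    refine (dist_pi_le_iff (mul_nonneg h0 dist_nonneg)).mpr fun s => ?_
    refine abs_ciSup_sub_ciSup_le fun a => ?_
    have : M.r s a + l * ∑ s', M.p s a s' * V s' - (M.r s a + l * ∑ s', M.p s a s' * W s')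
        = l * ((M.transMat fun _ => a).mulVec (V - W)) s := by
      rw [Matrix.mulVec_sub]
      change _ = l * (∑ s', M.p s a s' * V s' - ∑ s', M.p s a s' * W s')
      ring
    rw [this, abs_mul, abs_of_nonneg h0, dist_eq_norm]
    exact mul_le_mul_of_nonneg_left
      (abs_mulVec_le (M.transMat_mem_rowStochastic _) (V - W) s) h0
  exact ⟨hT.fixedPoint, fun s => (congrFun hT.fixedPoint_isFixedPt s).symm⟩

/-- The discounted analogue of `poissonMat`. -/
noncomputable def discountedMat (M : AMDP S A) (s₀ : S) (π : S → A) (l : ℝ) : Matrix S S ℝ :=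
  Matrix.of fun s s' => if s' = s₀ then 1 else (1 : Matrix S S ℝ) s s' - l * M.transMat π s s'

lemma discountedMat_one (π : S → A) : M.discountedMat s₀ π 1 = M.poissonMat s₀ π := by
  ext s s'
  simp [discountedMat, poissonMat]

/-- The rescaling (1 - l)V(s₀), V - V(s₀) turns the discounted equation into a linear system that
stays regular as the discount tends to 1, where it becomes the Poisson equation. -/
lemma discountedMat_mulVec (π : S → A) (l : ℝ) (V : S → ℝ)
    (hV : ∀ s, V s = M.r s (π s) + l * ∑ s', M.p s (π s) s' * V s') :
    (M.discountedMat s₀ π l).mulVec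
      (Function.update (fun s => V s - V s₀) s₀ ((1 - l) * V s₀)) = M.rew π := by
  funext s
  have h1 : ∀ u, M.discountedMat s₀ π l s u
        * Function.update (fun s => V s - V s₀) s₀ ((1 - l) * V s₀) u
      = (if u = s₀ then (1 - l) * V s₀ else 0)
      + ((1 : Matrix S S ℝ) s u * (V u - V s₀) - l * (M.transMat π s u * (V u - V s₀))) := by
    intro u
    by_cases hu : u = s₀
    · subst hu
      simp [discountedMat]
    · simp [discountedMat, hu]
      ring
  change ∑ u, M.discountedMat s₀ π l s u * _ = _
  rw [Finset.sum_congr rfl fun u _ => h1 u, Finset.sum_add_distrib, Finset.sum_sub_distrib,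
    Finset.sum_ite_eq' Finset.univ s₀, if_pos (Finset.mem_univ s₀), ← Finset.mul_sum]
  have h2 : ∑ u, (1 : Matrix S S ℝ) s u * (V u - V s₀) = V s - V s₀ :=
    congrFun (Matrix.one_mulVec fun u => V u - V s₀) s
  have h3 : ∑ u, M.transMat π s u * (V u - V s₀) = ∑ u, M.p s (π s) u * V u - V s₀ :=
    mulVec_sub_const (M.transMat_mem_rowStochastic π) V (V s₀) s
  rw [h2, h3]
  change _ = M.r s (π s)
  linarith [hV s]

lemma continuousAt_discountedMat_inv_mulVec {π : S → A} (hU : IsUnit (M.poissonMat s₀ π))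
    (r : S → ℝ) : ContinuousAt (fun l => (M.discountedMat s₀ π l)⁻¹.mulVec r) 1 := by
  have hc : Continuous fun l => M.discountedMat s₀ π l := by
    refine continuous_matrix fun s s' => ?_
    simp only [discountedMat, Matrix.of_apply]
    split_ifs <;> fun_prop
  have hd : (M.discountedMat s₀ π 1).det ≠ 0 := by
    rw [discountedMat_one]
    exact ((Matrix.isUnit_iff_isUnit_det _).mp hU).ne_zero
  simp only [Matrix.inv_def, Ring.inverse_eq_inv', Matrix.smul_mulVec]
  refine ContinuousAt.smul (hc.matrix_det.continuousAt.inv₀ hd) ?_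
  exact (hc.matrix_adjugate.matrix_mulVec continuous_const).continuousAt

/-- The average-reward optimality equation has a solution which is the limit of the solutions of
the discounted ones, provided that the Poisson equations of all policies are nondegenerate. -/
lemma exists_optimality_solution (M : AMDP S A) (s₀ : S)
    (hU : ∀ π : S → A, IsUnit (M.poissonMat s₀ π)) :
    ∃ (π : S → A) (h : S → ℝ), (M.poissonMat s₀ π).mulVec h = M.rew π ∧
      ∀ s a, M.r s a + ∑ s', M.p s a s' * Function.update h s₀ 0 s'
        ≤ h s₀ + Function.update h s₀ 0 s := by
  -- If the Poisson solution of every policy strictly violates some optimality inequality, the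
  -- violation persists by continuity for discounts near 1, for all of the finitely many policies at
  -- once. The greedy policy of a discounted value violates none.
  by_contra hcon
  push Not at hcon
  let H : (S → A) → ℝ → S → ℝ := fun π l => (M.discountedMat s₀ π l)⁻¹.mulVec (M.rew π)
  have hcont : ∀ π, ContinuousAt (H π) 1 := fun π =>
    continuousAt_discountedMat_inv_mulVec (hU π) _
  have hev : ∀ π : S → A, ∀ᶠ l in 𝓝 (1 : ℝ), (M.discountedMat s₀ π l).det ≠ 0 ∧
      ∃ s a, H π l s₀ + Function.update (H π l) s₀ 0 s
        < M.r s a + l * ∑ s', M.p s a s' * Function.update (H π l) s₀ 0 s' := by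
    intro π
    have hH1 : (M.poissonMat s₀ π).mulVec (H π 1) = M.rew π := by
      simp only [H, discountedMat_one]
      exact mulVec_inv_mulVec (hU π) _
    obtain ⟨s, a, hsa⟩ := hcon π _ hH1
    have hc : Continuous fun l => (M.discountedMat s₀ π l).det := by
      refine Continuous.matrix_det (continuous_matrix fun s s' => ?_)
      simp only [discountedMat, Matrix.of_apply]
      split_ifs <;> fun_prop
    have hd : (M.discountedMat s₀ π 1).det ≠ 0 := by
      rw [discountedMat_one]
      exact ((Matrix.isUnit_iff_isUnit_det _).mp (hU π)).ne_zero
    have hcoord : ∀ u, ContinuousAt (fun l => Function.update (H π l) s₀ 0 u) 1 := by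
      intro u
      by_cases hu : u = s₀
      · simp only [hu, Function.update_self]
        exact continuousAt_const
      · simp only [Function.update_of_ne hu]
        exact (continuousAt_apply u _).comp (hcont π)
    have hL : ContinuousAt (fun l => H π l s₀ + Function.update (H π l) s₀ 0 s) 1 :=
      ((continuousAt_apply s₀ _).comp (hcont π)).add (hcoord s)
    have hR : ContinuousAt (fun l => M.r s a
        + l * ∑ s', M.p s a s' * Function.update (H π l) s₀ 0 s') 1 :=
      continuousAt_const.add (continuousAt_id.mul
        (tendsto_finsetSum _ fun u _ => (hcoord u).const_mul _))
    filter_upwards [hc.continuousAt.eventually_ne hd, hL.eventually_lt hR (by simpa using hsa)]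
      with l h1 h2
    exact ⟨h1, s, a, h2⟩
  have hev' := (eventually_all.mpr hev).filter_mono (nhdsWithin_le_nhds (s := Set.Iio 1))
  have hev2 : ∀ᶠ l in 𝓝[<] (1 : ℝ), 0 ≤ l ∧ l < 1 := by
    filter_upwards [Ioo_mem_nhdsLT (show (0 : ℝ) < 1 by norm_num)] with l hl
    exact ⟨hl.1.le, hl.2⟩
  obtain ⟨l, hl, hl0, hl1⟩ := (hev'.and hev2).exists
  obtain ⟨V, hV⟩ := exists_discounted_value M hl0 hl1
  choose π hπ using fun s => exists_eq_ciSup_of_finite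
    (f := fun a => M.r s a + l * ∑ s', M.p s a s' * V s')
  obtain ⟨hdet, s, a, hlt⟩ := hl π
  have hmul := discountedMat_mulVec (M := M) (s₀ := s₀) π l V fun s => (hV s).trans (hπ s).symm
  -- The discounted matrix is invertible at this `l`, so `H π l` is the rescaled value `V` itself.
  have hHV : H π l = Function.update (fun s => V s - V s₀) s₀ ((1 - l) * V s₀) := by
    simp only [H]
    rw [← hmul, Matrix.mulVec_mulVec, Matrix.nonsing_inv_mul _ (isUnit_iff_ne_zero.mpr hdet),
      Matrix.one_mulVec]
  have hup : Function.update (H π l) s₀ 0 = fun s => V s - V s₀ := by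
    rw [hHV, Function.update_idem]
    funext u
    by_cases hu : u = s₀ <;> simp [hu]
  have h3 : ∑ u, M.p s a u * (V u - V s₀) = ∑ u, M.p s a u * V u - V s₀ :=
    mulVec_sub_const (M.transMat_mem_rowStochastic fun _ => a) V (V s₀) s
  rw [hup, hHV, Function.update_self, h3] at hlt
  have h4 := le_ciSup (Set.finite_range
    fun a => M.r s a + l * ∑ s', M.p s a s' * V s').bddAbove a
  rw [← hV s] at h4
  linarith

lemma exists_isOptBias (M : AMDP S A) (s₀ : S)
    (hU : ∀ π : S → A, IsUnit (M.poissonMat s₀ π)) : ∃ b, M.IsOptBias b := by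
  have : Nonempty S := ⟨s₀⟩
  obtain ⟨π, h, hh, hopt⟩ := exists_optimality_solution M s₀ hU
  set b := Function.update h s₀ 0 with hb
  have hpoi := poisson_of_poissonMat_mulVec hh
  rw [← hb] at hpoi
  refine ⟨b, h s₀, fun s => le_antisymm (ciSup_le fun π' => ?_) ?_, fun s => ?_⟩
  · have hh' := mulVec_inv_mulVec (hU π') (M.rew π')
    set h' := (M.poissonMat s₀ π')⁻¹.mulVec (M.rew π')
    have hpoi' := poisson_of_poissonMat_mulVec hh'
    rw [gain_eq_of_poissonMat_mulVec hh']
    -- The difference `w` of the two biases satisfies g' + w ≤ g + P_π' w, so the maximum principle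
    -- gives g' ≤ g.
    refine le_of_add_le_mulVec (M.transMat_mem_rowStochastic π')
      (w := Function.update h' s₀ 0 - b) fun s => ?_
    have h1 : M.rew π' s + ((M.transMat π').mulVec b) s ≤ h s₀ + b s := hopt s (π' s)
    rw [Matrix.mulVec_sub, Pi.sub_apply, Pi.sub_apply]
    linarith [hpoi' s]
  · rw [← gain_eq_of_poissonMat_mulVec hh s]
    exact le_ciSup (f := fun π => M.gain π s) (Set.finite_range _).bddAbove π
  · refine le_antisymm ?_ (ciSup_le fun a => hopt s a)
    refine le_trans (le_of_eq ?_) (le_ciSup (Set.finite_range _).bddAbove (π s))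
    have h1 : h s₀ + (b s - ∑ s', M.p s (π s) s' * b s') = M.r s (π s) := hpoi s
    linarith

/-- An optimal bias vector which vanishes at the reference state solves the Poisson equation of a
greedy policy. -/
lemma IsOptBias.exists_poissonMat_mulVec {b : S → ℝ} (hb : M.IsOptBias b) (h0 : b s₀ = 0) :
    ∃ (π : S → A) (h : S → ℝ), (M.poissonMat s₀ π).mulVec h = M.rew π ∧ ‖b‖ ≤ ‖h‖ := by
  obtain ⟨g, -, hg⟩ := hb
  choose π hπ using fun s => exists_eq_ciSup_of_finite
    (f := fun a => M.r s a + ∑ s', M.p s a s' * b s')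
  have hup : Function.update (Function.update b s₀ g) s₀ 0 = b := by
    rw [Function.update_idem, ← h0, Function.update_eq_self]
  refine ⟨π, Function.update b s₀ g, ?_, ?_⟩
  · funext s
    rw [poissonMat_mulVec, hup, Function.update_self]
    have h1 := (hg s).trans (hπ s).symm
    change g + (b s - ∑ s', M.p s (π s) s' * b s') = M.r s (π s)
    linarith
  · refine (pi_norm_le_iff_of_nonneg (norm_nonneg _)).mpr fun s => ?_
    by_cases hs : s = s₀
    · rw [hs, h0, norm_zero]
      exact norm_nonneg _
    · have := norm_le_pi_norm (Function.update b s₀ g) s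
      rwa [Function.update_of_ne hs] at this

/-- A small perturbation of the transition probabilities of a unichain MDP has an optimal bias,
and the normalised optimal biases are bounded in terms of the complexity constants of `M`. -/
lemma isOptBias_of_perturbation {M' : AMDP S A} {β : AMDP S A → S → ℝ}
    (hβ : IsBiasRoutine s₀ β) (hu : M.Unichain) {η : ℝ}
    (hgap : 0 < M.gap) (hη0 : 0 ≤ η) (hη : M.Gam s₀ * η ≤ M.gap / 12) (hr : M'.r = M.r)
    (hpp : ∀ s a, ∑ s', |M.p s a s' - M'.p s a s'| ≤ η) :
    M'.IsOptBias (β M') ∧ ‖β M'‖ ≤ 6 * M.cplx s₀ := by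
  obtain ⟨hopt, h0⟩ := hβ M' (exists_isOptBias M' s₀
    (poissonMat_isUnit_of_perturbation hu hgap hη0 hη hpp))
  refine ⟨hopt, ?_⟩
  obtain ⟨π, v, hv, hle⟩ := hopt.exists_poissonMat_mulVec h0
  have hU : IsUnit (M.poissonMat s₀ π) := poissonMat_isUnit_of_unichainMat (hu π)
  have hh := mulVec_inv_mulVec hU (M.rew π)
  have hrew : M'.rew π = M.rew π := by
    funext s
    simp [rew, hr]
  -- `π` is greedy for `M'` and need not be optimal in `M`. This is harmless, as Δ₂ is a maximum
  -- over policies.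
  have h1 := norm_le_of_perturbation hu hgap hη0 hη hpp π (hv.trans (hrew.trans hh.symm))
  have h2 := norm_le_Delta2 (hu π) hh
  have h3 : M.Delta2 s₀ ≤ M.Gam s₀ := by
    unfold Gam
    nlinarith [one_le_Delta1 (s₀ := s₀) (hu π), Delta2_nonneg (M := M) (s₀ := s₀)]
  have h4 : M.Gam s₀ ≤ M.cplx s₀ := le_max_right _ _
  linarith [one_le_cplx (M := M) (s₀ := s₀)]

end OptimalBias

end AMDP

namespace AMDP

/-! ### Pinsker's inequality -/

section Pinsker

lemma two_mul_sub_one_le_log {t : ℝ} (ht : 1 ≤ t) : 2 * (t - 1) ≤ (t + 1) * Real.log t := by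
  have h := Real.le_log_one_add_of_nonneg (sub_nonneg.mpr ht)
  rw [add_sub_cancel, div_le_iff₀ (by linarith)] at h
  linarith

lemma log_le_two_mul_sub_one {t : ℝ} (h0 : 0 < t) (ht : t ≤ 1) :
    (t + 1) * Real.log t ≤ 2 * (t - 1) := by
  have h := two_mul_sub_one_le_log ((one_le_inv₀ h0).mpr ht)
  rw [Real.log_inv] at h
  have h1 := mul_le_mul_of_nonneg_left h h0.le
  have e1 : t * (2 * (t⁻¹ - 1)) = 2 * (1 - t) := by field_simp
  have e2 : t * ((t⁻¹ + 1) * -Real.log t) = -((t + 1) * Real.log t) := by field_simp; ring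
  linarith

lemma three_mul_sq_le {t : ℝ} (h0 : 0 < t) :
    3 * (t - 1) ^ 2 ≤ (2 * t + 4) * (t * Real.log t - t + 1) := by
  -- The difference `f` of the two sides vanishes at 1, and its derivative has the sign of t - 1 by
  -- the two logarithm bounds above.
  let f : ℝ → ℝ := fun t => (2 * t + 4) * (t * Real.log t - t + 1) - 3 * (t - 1) ^ 2
  have hd : ∀ t : ℝ, 0 < t → HasDerivAt f (4 * ((t + 1) * Real.log t - 2 * (t - 1))) t := by
    intro t ht
    have h1 := ((hasDerivAt_id t).const_mul 2).add_const 4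
    have h2 := (((hasDerivAt_id t).mul (Real.hasDerivAt_log ht.ne')).sub
      (hasDerivAt_id t)).add_const 1
    have h3 := (((hasDerivAt_id t).sub_const 1).pow 2).const_mul 3
    refine ((h1.mul h2).sub h3).congr_deriv ?_
    simp
    field_simp
    ring
  have hf1 : f 1 = 0 := by simp [f]
  have hcont : ∀ s ⊆ Set.Ioi (0 : ℝ), ContinuousOn f s := fun s hs t ht =>
    (hd t (hs ht)).continuousAt.continuousWithinAt
  have hpos : 0 ≤ f t := by
    rcases le_total t 1 with h | h
    · have : AntitoneOn f (Set.Icc t 1) := by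
        refine antitoneOn_of_deriv_nonpos (convex_Icc t 1)
          (hcont _ fun x hx => h0.trans_le hx.1) ?_ ?_
        · intro x hx
          rw [interior_Icc] at hx
          exact (hd x (h0.trans hx.1)).differentiableAt.differentiableWithinAt
        · intro x hx
          rw [interior_Icc] at hx
          rw [(hd x (h0.trans hx.1)).deriv]
          linarith [log_le_two_mul_sub_one (h0.trans hx.1) hx.2.le]
      rw [← hf1]
      exact this ⟨le_rfl, h⟩ ⟨h, le_rfl⟩ h
    · have : MonotoneOn f (Set.Icc 1 t) := by
        refine monotoneOn_of_deriv_nonneg (convex_Icc 1 t)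
          (hcont _ fun x hx => zero_lt_one.trans_le hx.1) ?_ ?_
        · intro x hx
          rw [interior_Icc] at hx
          exact (hd x (zero_lt_one.trans hx.1)).differentiableAt.differentiableWithinAt
        · intro x hx
          rw [interior_Icc] at hx
          rw [(hd x (zero_lt_one.trans hx.1)).deriv]
          linarith [two_mul_sub_one_le_log hx.1.le]
      rw [← hf1]
      exact this ⟨le_rfl, h⟩ ⟨h, le_rfl⟩ h
  exact sub_nonneg.mp hpos

lemma three_mul_sub_sq_le {p q : ℝ} (hp : 0 ≤ p) (hq : 0 ≤ q) (hpq : q = 0 → p = 0) :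
    0 ≤ p * Real.log (p / q) - p + q ∧
      3 * (p - q) ^ 2 ≤ (2 * p + 4 * q) * (p * Real.log (p / q) - p + q) := by
  rcases hq.eq_or_lt with h | hq
  · simp [← h, hpq h.symm]
  rcases hp.eq_or_lt with h | hp
  · simp only [← h]
    constructor <;> nlinarith
  have h := three_mul_sq_le (div_pos hp hq)
  have e1 : p * Real.log (p / q) - p + q
      = q * (p / q * Real.log (p / q) - p / q + 1) := by field_simp
  have e2 : 3 * (p - q) ^ 2 = q ^ 2 * (3 * (p / q - 1) ^ 2) := by field_simp
  have e3 : 2 * p + 4 * q = q * (2 * (p / q) + 4) := by field_simp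
  have hpq' := div_pos hp hq
  have hnn : 0 ≤ p / q * Real.log (p / q) - p / q + 1 := by
    by_contra hc
    push Not at hc
    nlinarith [sq_nonneg (p / q - 1)]
  rw [e1]
  refine ⟨by positivity, ?_⟩
  rw [e2, e3]
  nlinarith [mul_le_mul_of_nonneg_left h (sq_nonneg q)]

/-- Pinsker's inequality on a finite set. -/
lemma sum_abs_sub_sq_le {S : Type u} [Fintype S] {p q : S → ℝ} (hp : p ∈ stdSimplex ℝ S)
    (hq : q ∈ stdSimplex ℝ S) (hpq : ∀ s, q s = 0 → p s = 0) :
    (∑ s, |p s - q s|) ^ 2 ≤ 2 * ∑ s, p s * Real.log (p s / q s) := by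
  have h := fun s => three_mul_sub_sq_le (hp.1 s) (hq.1 s) (hpq s)
  -- Cauchy–Schwarz: the weights (2p + 4q)/3 sum to 2, and the nonnegative terms p log(p/q) - p + q
  -- sum to the divergence.
  have h1 := Finset.sum_sq_le_sum_mul_sum_of_sq_le_mul Finset.univ (r := fun s => |p s - q s|)
    (f := fun s => (2 * p s + 4 * q s) / 3)
    (g := fun s => p s * Real.log (p s / q s) - p s + q s)
    (fun s _ => by have := hp.1 s; have := hq.1 s; positivity) (fun s _ => (h s).1)
    (fun s _ => by rw [sq_abs]; linarith [(h s).2])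
  refine h1.trans (le_of_eq ?_)
  rw [← Finset.sum_div, Finset.sum_add_distrib, Finset.sum_add_distrib, Finset.sum_sub_distrib,
    ← Finset.mul_sum, ← Finset.mul_sum, hp.2, hq.2]
  ring

lemma sum_abs_sub_le_sqrt {S : Type u} [Fintype S] [DecidableEq S] {p q : S → ℝ}
    (hp : p ∈ stdSimplex ℝ S) (hq : q ∈ stdSimplex ℝ S) {n : ℕ} (hn : n ≠ 0) {x : ℝ}
    (h : ((n : ℝ) : EReal) * kl p q ≤ (x : EReal)) :
    ∑ s, |p s - q s| ≤ √(2 * x / n) := by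
  have hn' : (0 : ℝ) < n := by positivity
  unfold kl at h
  split_ifs at h with hpq
  · rw [← EReal.coe_mul, EReal.coe_le_coe_iff] at h
    refine Real.le_sqrt_of_sq_le ((sum_abs_sub_sq_le hp hq hpq).trans ?_)
    rw [le_div_iff₀ hn']
    linarith
  · rw [EReal.coe_mul_top_of_pos hn'] at h
    exact absurd h (by simp)

end Pinsker

/-! ### Mixture likelihood ratio and its comparison with the divergence -/

section Mixture

variable {S : Type u} [Fintype S] [DecidableEq S]

/-- Number of occurrences of `s` among the first `n` terms of the sequence `x`. -/
def occ (x : ℕ → S) (n : ℕ) (s : S) : ℕ := ((Finset.range n).filter fun i => x i = s).card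

lemma sum_occ (x : ℕ → S) (n : ℕ) : ∑ s, occ x n s = n := by
  unfold occ
  rw [← Finset.card_eq_sum_card_fiberwise (s := Finset.range n) (t := Finset.univ) (f := x)
    (fun _ _ => by simp), Finset.card_range]

lemma occ_congr {x y : ℕ → S} {n : ℕ} (h : ∀ i < n, x i = y i) : occ x n = occ y n := by
  funext s
  unfold occ
  congr 1
  refine Finset.filter_congr fun i hi => ?_
  rw [h i (Finset.mem_range.mp hi)]

lemma occ_succ (x : ℕ → S) (n : ℕ) : occ x (n + 1) = occ x n + Pi.single (x n) 1 := by
  funext s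
  unfold occ
  rw [Finset.range_add_one, Finset.filter_insert, Pi.add_apply]
  split_ifs with h
  · rw [Finset.card_insert_of_notMem (by simp), ← h, Pi.single_eq_same]
  · rw [Pi.single_eq_of_ne (fun h' => h h'.symm), add_zero]

/-- Ratio between the likelihood of a sample with counts `N` under the mixture of all probability
vectors (uniform prior on the simplex), and its likelihood under `p`. -/
noncomputable def mixtureRatio (p : S → ℝ) (N : S → ℕ) : ℝ :=
  (∏ s, ((N s).factorial : ℝ) / p s ^ N s)
    * (((Fintype.card S - 1).factorial : ℝ) / ((∑ s, N s + (Fintype.card S - 1)).factorial : ℝ))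

lemma mixtureRatio_zero (p : S → ℝ) : mixtureRatio p 0 = 1 := by
  simp only [mixtureRatio, Pi.zero_apply, Nat.factorial_zero, pow_zero, Finset.sum_const_zero,
    zero_add]
  rw [div_self (by positivity)]
  simp

lemma mixtureRatio_nonneg {p : S → ℝ} (hp : ∀ s, 0 ≤ p s) (N : S → ℕ) :
    0 ≤ mixtureRatio p N :=
  mul_nonneg (Finset.prod_nonneg fun s _ => div_nonneg (by positivity) (pow_nonneg (hp s) _))
    (by positivity)

/-- Laplace's rule of succession: under the uniform prior the next letter is `s` with probability
(N_s + 1)/(n + S). -/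
lemma mixtureRatio_add_single {p : S → ℝ} {s : S} (hs : p s ≠ 0) (N : S → ℕ) :
    p s * mixtureRatio p (N + Pi.single s 1)
      = mixtureRatio p N * ((N s + 1) / (∑ u, N u + Fintype.card S)) := by
  have hcard : 1 ≤ Fintype.card S := Fintype.card_pos_iff.mpr ⟨s⟩
  have hsum : ∑ u, (N + Pi.single s 1 : S → ℕ) u + (Fintype.card S - 1)
      = (∑ u, N u + (Fintype.card S - 1)) + 1 := by
    simp only [Pi.add_apply, Finset.sum_add_distrib, Finset.sum_pi_single', Finset.mem_univ,
      if_true]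
    omega
  have hprod : ∏ u, (((N + Pi.single s 1 : S → ℕ) u).factorial : ℝ)
        / p u ^ (N + Pi.single s 1 : S → ℕ) u
      = (∏ u, ((N u).factorial : ℝ) / p u ^ N u) * ((N s + 1) / p s) := by
    rw [← Finset.mul_prod_erase _ _ (Finset.mem_univ s),
      ← Finset.mul_prod_erase _ (fun u => ((N u).factorial : ℝ) / p u ^ N u) (Finset.mem_univ s)]
    have h1 : ∀ u ∈ Finset.univ.erase s,
        (((N + Pi.single s 1 : S → ℕ) u).factorial : ℝ) / p u ^ (N + Pi.single s 1 : S → ℕ) u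
          = ((N u).factorial : ℝ) / p u ^ N u := by
      intro u hu
      rw [Pi.add_apply, Pi.single_eq_of_ne (Finset.ne_of_mem_erase hu), add_zero]
    rw [Finset.prod_congr rfl h1, Pi.add_apply, Pi.single_eq_same, Nat.factorial_succ, pow_succ]
    push_cast
    field_simp
  have hcast : ((∑ u, N u + (Fintype.card S - 1) + 1 : ℕ) : ℝ)
      = ∑ u, (N u : ℝ) + Fintype.card S := by
    rw [add_assoc, Nat.sub_add_cancel hcard]
    push_cast
    ring
  have hpos : (0 : ℝ) < ∑ u, (N u : ℝ) + Fintype.card S := by positivity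
  unfold mixtureRatio
  rw [hprod, hsum, Nat.factorial_succ, Nat.cast_mul, hcast]
  push_cast
  field_simp

/-- The supermartingale property. Letters of probability zero contribute nothing on the left, so
equality may fail. -/
lemma sum_mul_mixtureRatio_le [Nonempty S] {p : S → ℝ} (hp : ∀ s, 0 ≤ p s) (N : S → ℕ) :
    ∑ s, p s * mixtureRatio p (N + Pi.single s 1) ≤ mixtureRatio p N := by
  have hpos : (0 : ℝ) < ∑ u, (N u : ℝ) + Fintype.card S := by positivity
  have h0 := mixtureRatio_nonneg hp N
  calc ∑ s, p s * mixtureRatio p (N + Pi.single s 1)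
      ≤ ∑ s, mixtureRatio p N * ((N s + 1) / (∑ u, N u + Fintype.card S)) := by
        refine Finset.sum_le_sum fun s _ => ?_
        by_cases hs : p s = 0
        · rw [hs, zero_mul]
          positivity
        · exact (mixtureRatio_add_single hs N).le
    _ = mixtureRatio p N := by
        rw [← Finset.mul_sum, ← Finset.sum_div, Finset.sum_add_distrib]
        simp only [Finset.sum_const, Finset.card_univ, nsmul_eq_mul, mul_one]
        rw [Nat.cast_sum, div_self hpos.ne', mul_one]

/-- Maximum likelihood under the multinomial distribution. -/
lemma prod_pow_le_prod_factorial_div (N : S → ℕ) {n : ℕ} (hn : n ≠ 0) (hN : ∑ s, N s = n) :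
    ∏ s, ((N s : ℝ) / n) ^ N s ≤ (∏ s, ((N s).factorial : ℝ)) / n.factorial := by
  have hn' : (n : ℝ) ≠ 0 := by exact_mod_cast hn
  -- The multinomial theorem expands (∑ N_s/n)^n = 1 into nonnegative terms, of which only the one
  -- indexed by `N` is kept.
  have h1 := Finset.sum_pow_eq_sum_piAntidiag (R := ℝ) Finset.univ (fun s => (N s : ℝ) / n) n
  rw [← Finset.sum_div, ← Nat.cast_sum, hN, div_self hn', one_pow] at h1
  have hmem : N ∈ Finset.piAntidiag Finset.univ n := by
    rw [Finset.mem_piAntidiag]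
    exact ⟨hN, fun _ _ => Finset.mem_univ _⟩
  have h2 := Finset.single_le_sum (f := fun k : S → ℕ =>
    (Nat.multinomial Finset.univ k : ℝ) * ∏ s, ((N s : ℝ) / n) ^ k s)
    (fun k _ => by positivity) hmem
  rw [← h1] at h2
  have h3 : (∏ s, ((N s).factorial : ℝ)) * Nat.multinomial Finset.univ N = n.factorial := by
    have := Nat.multinomial_spec Finset.univ N
    rw [hN] at this
    exact_mod_cast this
  have h4 : (0 : ℝ) < ∏ s, ((N s).factorial : ℝ) := by positivity
  rw [le_div_iff₀ (by positivity), ← h3]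
  nlinarith

/-- The left side is the binomial coefficient of n+m over m, at most (n+m)^m/m!, and m^m/m! ≤ e^m.
With m = S - 1 the right side is the exponential of the second term of the threshold. -/
lemma factorial_add_div_le {m : ℕ} (hm : m ≠ 0) (n : ℕ) :
    ((n + m).factorial : ℝ) / (n.factorial * m.factorial)
      ≤ (Real.exp 1 * (1 + (n : ℝ) / m)) ^ m := by
  have hm' : (0 : ℝ) < m := by positivity
  have h1 : ((n + m).factorial : ℝ) / (n.factorial * m.factorial) = ((n + m).choose m : ℝ) := by
    rw [Nat.cast_choose ℝ (Nat.le_add_left m n), Nat.add_sub_cancel, mul_comm (n.factorial : ℝ)]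
  have h2 : ((n + m).choose m : ℝ) ≤ ((n + m : ℕ) : ℝ) ^ m / m.factorial :=
    Nat.choose_le_pow_div m (n + m)
  have h3 := Real.pow_div_factorial_le_exp (m : ℝ) hm'.le m
  have h4 : ((n + m : ℕ) : ℝ) ^ m / m.factorial
      = (1 + (n : ℝ) / m) ^ m * ((m : ℝ) ^ m / m.factorial) := by
    rw [← mul_div_assoc, ← mul_pow]
    congr 2
    push_cast
    field_simp
    ring
  rw [h1, mul_pow, ← Real.exp_nat_mul, mul_one, mul_comm (Real.exp _)]
  refine h2.trans ?_
  rw [h4]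
  exact mul_le_mul_of_nonneg_left h3 (by positivity)

lemma exp_mul_kl_le_mixtureRatio (hS : 2 ≤ Fintype.card S) {p : S → ℝ} (hp : ∀ s, 0 ≤ p s)
    (N : S → ℕ) {n : ℕ} (hn : n ≠ 0) (hN : ∑ s, N s = n) (hpN : ∀ s, p s = 0 → N s = 0) :
    Real.exp (n * ∑ s, (N s : ℝ) / n * Real.log ((N s : ℝ) / n / p s)
      - ((Fintype.card S : ℝ) - 1)
        * Real.log (Real.exp 1 * (1 + (n : ℝ) / ((Fintype.card S : ℝ) - 1))))
      ≤ mixtureRatio p N := by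
  have hn' : (0 : ℝ) < n := by positivity
  set m := Fintype.card S - 1 with hm
  have hm0 : m ≠ 0 := by omega
  have hcast : (Fintype.card S : ℝ) - 1 = m := by
    rw [hm, Nat.cast_sub (by omega)]
    simp
  have hB : (0 : ℝ) < Real.exp 1 * (1 + (n : ℝ) / m) := by positivity
  have h1 : Real.exp (n * ∑ s, (N s : ℝ) / n * Real.log ((N s : ℝ) / n / p s))
      = (∏ s, ((N s : ℝ) / n) ^ N s) / ∏ s, p s ^ N s := by
    rw [Finset.mul_sum, Real.exp_sum, ← Finset.prod_div_distrib]
    refine Finset.prod_congr rfl fun s _ => ?_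
    by_cases hs : N s = 0
    · simp [hs]
    · have hps : 0 < p s := (hp s).lt_of_ne fun h => hs (hpN s h.symm)
      have hNs : (0 : ℝ) < N s := by positivity
      rw [← div_pow, ← mul_assoc, mul_div_cancel₀ _ hn'.ne', Real.exp_nat_mul,
        Real.exp_log (by positivity)]
  have h2 : 0 ≤ ∏ s, p s ^ N s := Finset.prod_nonneg fun s _ => pow_nonneg (hp s) _
  rw [hcast, Real.exp_sub, h1, ← Real.log_pow, Real.exp_log (by positivity)]
  have h3 := prod_pow_le_prod_factorial_div N hn hN
  have h4 := factorial_add_div_le hm0 n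
  unfold mixtureRatio
  rw [Finset.prod_div_distrib, ← hm, hN, div_mul_eq_mul_div, div_right_comm]
  refine div_le_div_of_nonneg_right ?_ h2
  calc _ ≤ (∏ s, ((N s).factorial : ℝ)) / n.factorial
        / (((n + m).factorial : ℝ) / (n.factorial * m.factorial)) := by
        refine div_le_div₀ (by positivity) h3 (by positivity) h4
    _ = _ := by field_simp

end Mixture

/-! ### Ville's inequality and time-uniform KL concentration -/

section Ville

variable {S : Type u} [Fintype S] [DecidableEq S] [Nonempty S] {Ω : Type w} [MeasurableSpace Ω]
  {μ : Measure Ω} {Y : ℕ → Ω → S} {p : S → ℝ}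

/-- Ville's inequality for the mixture likelihood ratio, on a cylinder set. -/
lemma measure_cylinder_inter_le (hp : ∀ s, 0 ≤ p s)
    (hY : ∀ (x : ℕ → S) (m : ℕ), μ {ω | ∀ i < m, Y i ω = x i}
      = ENNReal.ofReal (∏ i ∈ Finset.range m, p (x i))) {c : ℝ} (hc : 0 < c) (n : ℕ) :
    ∀ (m : ℕ) (x : ℕ → S),
      μ {ω | (∀ i < m, Y i ω = x i) ∧
          ∃ k, m ≤ k ∧ k ≤ m + n ∧ c ≤ mixtureRatio p (occ (fun i => Y i ω) k)}
        ≤ ENNReal.ofReal ((∏ i ∈ Finset.range m, p (x i)) * (mixtureRatio p (occ x m) / c)) := by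
  -- Once the ratio has reached `c` on the prefix, the probability of the whole cylinder is already
  -- small enough.
  have key : ∀ (m : ℕ) (x : ℕ → S), c ≤ mixtureRatio p (occ x m) →
      ∀ B : Set Ω, B ⊆ {ω | ∀ i < m, Y i ω = x i} →
      μ B ≤ ENNReal.ofReal ((∏ i ∈ Finset.range m, p (x i)) * (mixtureRatio p (occ x m) / c)) := by
    intro m x hx B hB
    refine (measure_mono hB).trans ?_
    rw [hY]
    exact ENNReal.ofReal_le_ofReal (le_mul_of_one_le_right
      (Finset.prod_nonneg fun i _ => hp _) ((one_le_div hc).mpr hx))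
  induction n with
  | zero =>
    intro m x
    by_cases hx : c ≤ mixtureRatio p (occ x m)
    · exact key m x hx _ fun ω hω => hω.1
    · refine le_of_eq_of_le ?_ zero_le
      rw [show {ω | (∀ i < m, Y i ω = x i) ∧ ∃ k, m ≤ k ∧ k ≤ m + 0 ∧
        c ≤ mixtureRatio p (occ (fun i => Y i ω) k)} = ∅ from ?_, measure_empty]
      refine Set.eq_empty_iff_forall_notMem.mpr ?_
      rintro ω ⟨h1, k, h2, h3, h4⟩
      obtain rfl : k = m := by omega
      rw [occ_congr h1] at h4
      exact hx h4
  | succ n ih =>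
    intro m x
    by_cases hx : c ≤ mixtureRatio p (occ x m)
    · exact key m x hx _ fun ω hω => hω.1
    have hprod : ∀ s, ∏ i ∈ Finset.range (m + 1), p (Function.update x m s i)
        = (∏ i ∈ Finset.range m, p (x i)) * p s := by
      intro s
      rw [Finset.prod_range_succ, Function.update_self]
      congr 1
      refine Finset.prod_congr rfl fun i hi => ?_
      rw [Function.update_of_ne (Finset.mem_range.mp hi).ne]
    have hocc : ∀ s, occ (Function.update x m s) (m + 1) = occ x m + Pi.single s 1 := by
      intro s
      rw [occ_succ, Function.update_self,
        occ_congr fun i hi => Function.update_of_ne (ne_of_lt hi) _ _]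
    -- Condition on the next letter. The ratio at time `m` depends only on the prefix and is below
    -- `c`, so the crossing happens at time `m + 1` or later.
    calc _ ≤ μ (⋃ s, {ω | (∀ i < m + 1, Y i ω = Function.update x m s i) ∧
          ∃ k, m + 1 ≤ k ∧ k ≤ m + 1 + n ∧ c ≤ mixtureRatio p (occ (fun i => Y i ω) k)}) := by
          refine measure_mono ?_
          rintro ω ⟨h1, k, h2, h3, h4⟩
          refine Set.mem_iUnion.mpr ⟨Y m ω, fun i hi => ?_, k, ?_, by omega, h4⟩
          · rcases Nat.lt_succ_iff_lt_or_eq.mp hi with h | rfl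
            · rw [Function.update_of_ne h.ne, h1 i h]
            · rw [Function.update_self]
          · rcases h2.eq_or_lt with rfl | h
            · rw [occ_congr h1] at h4
              exact absurd h4 hx
            · exact h
      _ ≤ ∑ s, μ {ω | (∀ i < m + 1, Y i ω = Function.update x m s i) ∧
          ∃ k, m + 1 ≤ k ∧ k ≤ m + 1 + n ∧ c ≤ mixtureRatio p (occ (fun i => Y i ω) k)} :=
          measure_iUnion_fintype_le _ _
      _ ≤ ∑ s, ENNReal.ofReal ((∏ i ∈ Finset.range m, p (x i))
            * (p s * mixtureRatio p (occ x m + Pi.single s 1) / c)) := by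
          refine Finset.sum_le_sum fun s _ => ?_
          have := ih (m + 1) (Function.update x m s)
          rwa [hprod, hocc, mul_assoc, ← mul_div_assoc] at this
      _ ≤ _ := by
          have hP : 0 ≤ ∏ i ∈ Finset.range m, p (x i) := Finset.prod_nonneg fun i _ => hp _
          rw [← ENNReal.ofReal_sum_of_nonneg fun s _ => mul_nonneg hP
            (div_nonneg (mul_nonneg (hp s) (mixtureRatio_nonneg hp _)) hc.le)]
          refine ENNReal.ofReal_le_ofReal ?_
          rw [← Finset.mul_sum, ← Finset.sum_div]
          exact mul_le_mul_of_nonneg_left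
            (div_le_div_of_nonneg_right (sum_mul_mixtureRatio_le hp _) hc.le) hP

lemma measure_exists_mixtureRatio_ge_le (hp : ∀ s, 0 ≤ p s)
    (hY : ∀ (x : ℕ → S) (m : ℕ), μ {ω | ∀ i < m, Y i ω = x i}
      = ENNReal.ofReal (∏ i ∈ Finset.range m, p (x i))) {c : ℝ} (hc : 0 < c) :
    μ {ω | ∃ k, c ≤ mixtureRatio p (occ (fun i => Y i ω) k)} ≤ ENNReal.ofReal (1 / c) := by
  have hU : {ω | ∃ k, c ≤ mixtureRatio p (occ (fun i => Y i ω) k)}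
      = ⋃ n : ℕ, {ω | ∃ k ≤ n, c ≤ mixtureRatio p (occ (fun i => Y i ω) k)} := by
    ext ω
    simp only [Set.mem_ofPred_eq, Set.mem_iUnion]
    exact ⟨fun ⟨k, hk⟩ => ⟨k, k, le_rfl, hk⟩, fun ⟨_, k, _, hk⟩ => ⟨k, hk⟩⟩
  have hmono : Monotone fun n : ℕ =>
      {ω | ∃ k ≤ n, c ≤ mixtureRatio p (occ (fun i => Y i ω) k)} :=
    fun n n' h ω ⟨k, hk, hk'⟩ => ⟨k, hk.trans h, hk'⟩
  rw [hU, hmono.measure_iUnion]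
  refine iSup_le fun n => ?_
  obtain ⟨s⟩ := ‹Nonempty S›
  have h := measure_cylinder_inter_le hp hY hc n 0 fun _ => s
  have h0 : occ (fun _ : ℕ => s) 0 = 0 := by
    funext u
    simp [occ]
  rw [h0, mixtureRatio_zero] at h
  simpa using h

/-- Time-uniform concentration of empirical distributions in Kullback-Leibler divergence. -/
lemma measure_exists_kl_gt_le (hS : 2 ≤ Fintype.card S) (hp : p ∈ stdSimplex ℝ S)
    (hY : ∀ (x : ℕ → S) (m : ℕ), μ {ω | ∀ i < m, Y i ω = x i}
      = ENNReal.ofReal (∏ i ∈ Finset.range m, p (x i)))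
    (hY1 : ∀ i s, p s = 0 → μ {ω | Y i ω = s} = 0) {c : ℝ} (hc : 0 < c) :
    μ {ω | ∃ n : ℕ, n ≠ 0 ∧ ¬ ((n : ℝ) : EReal) * kl (fun s => (occ (fun i => Y i ω) n s : ℝ) / n) p
        ≤ ((Real.log c + ((Fintype.card S : ℝ) - 1)
          * Real.log (Real.exp 1 * (1 + (n : ℝ) / ((Fintype.card S : ℝ) - 1))) : ℝ) : EReal)}
      ≤ ENNReal.ofReal (1 / c) := by
  -- Samples containing a letter of probability zero have infinite divergence and escape the mixture
  -- bound, but they form a null set.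
  have hnull : μ {ω | ∃ i s, p s = 0 ∧ Y i ω = s} = 0 := by
    have : {ω | ∃ i s, p s = 0 ∧ Y i ω = s}
        = ⋃ (i : ℕ), ⋃ (s : S), ⋃ (_ : p s = 0), {ω | Y i ω = s} := by
      ext ω
      simp
    rw [this]
    exact measure_iUnion_null fun i => measure_iUnion_null fun s => measure_iUnion_null (hY1 i s)
  refine le_trans ?_ (measure_exists_mixtureRatio_ge_le hp.1 hY hc)
  refine le_trans (measure_mono (t := {ω | ∃ k, c ≤ mixtureRatio p (occ (fun i => Y i ω) k)}
    ∪ {ω | ∃ i s, p s = 0 ∧ Y i ω = s}) ?_) ((measure_union_le _ _).trans (by rw [hnull, add_zero]))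
  rintro ω ⟨n, hn, hgt⟩
  by_cases h0 : ∃ i s, p s = 0 ∧ Y i ω = s
  · exact Or.inr h0
  refine Or.inl ⟨n, ?_⟩
  push Not at h0
  have hac : ∀ s, p s = 0 → occ (fun i => Y i ω) n s = 0 := by
    intro s hs
    simp [occ, h0 _ s hs]
  have h1 := exp_mul_kl_le_mixtureRatio hS hp.1 (occ (fun i => Y i ω) n) hn (sum_occ _ n) hac
  refine le_trans ?_ h1
  rw [← Real.log_le_iff_le_exp hc]
  unfold kl at hgt
  rw [if_pos fun s hs => by simp [hac s hs], ← EReal.coe_mul, EReal.coe_le_coe_iff] at hgt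
  linarith

end Ville

end AMDP

namespace AMDP

/-! ### The stopping condition on the good event -/

section Stopping

variable {S : Type u} {A : Type v} [Fintype S] [DecidableEq S] [Fintype A]

lemma empProb_mem_stdSimplex (M : AMDP S A) (y : ℕ → S → A → S) (k : ℕ) (s : S) (a : A) :
    empProb y k s a ∈ stdSimplex ℝ S :=
  ⟨fun s' => (M.empMDP y k).p_nonneg s a s', (M.empMDP y k).p_sum s a⟩

lemma thr_nonneg (hS : 2 ≤ Fintype.card S) [Nonempty A] {δ : ℝ} (h0 : 0 < δ) (h1 : δ < 1)
    (k : ℕ) : 0 ≤ thr S A δ k := by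
  have hS' : (2 : ℝ) ≤ Fintype.card S := by exact_mod_cast hS
  have hA : (1 : ℝ) ≤ Fintype.card A := by exact_mod_cast Fintype.card_pos (α := A)
  have hd : (0 : ℝ) < (Fintype.card S : ℝ) - 1 := by linarith
  refine add_nonneg (Real.log_nonneg ?_) (mul_nonneg hd.le (Real.log_nonneg ?_))
  · rw [one_le_div h0]
    nlinarith
  · have h2 : (0 : ℝ) ≤ (k : ℝ) / ((Fintype.card S : ℝ) - 1) := by positivity
    nlinarith [Real.add_one_le_exp (1 : ℝ)]

lemma abs_sub_le_of_mem_klValues {δ : ℝ} {k : ℕ} (hk : k ≠ 0) {phat b : S → ℝ}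
    (hp : phat ∈ stdSimplex ℝ S) {z : ℝ} (hz : z ∈ klValues A δ k phat b) :
    |∑ s', phat s' * b s' - z| ≤ ‖b‖ * √(2 * thr S A δ k / k) := by
  obtain ⟨q, hq, hkl, rfl⟩ := hz
  have h1 := sum_abs_sub_le_sqrt hp hq hk hkl
  calc |∑ s', phat s' * b s' - ∑ s', q s' * b s'| = |∑ s', (phat s' - q s') * b s'| := by
        rw [← Finset.sum_sub_distrib]
        congr 1
        exact Finset.sum_congr rfl fun s _ => by ring
    _ ≤ ∑ s', |phat s' - q s'| * ‖b‖ := by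
        refine (Finset.abs_sum_le_sum_abs _ _).trans (Finset.sum_le_sum fun s _ => ?_)
        rw [abs_mul]
        exact mul_le_mul_of_nonneg_left (norm_le_pi_norm b s) (abs_nonneg _)
    _ ≤ ‖b‖ * √(2 * thr S A δ k / k) := by
        rw [← Finset.sum_mul, mul_comm]
        exact mul_le_mul_of_nonneg_left h1 (norm_nonneg _)

lemma klValues_nonempty {δ : ℝ} {k : ℕ} (hthr : 0 ≤ thr S A δ k) {phat : S → ℝ}
    (hp : phat ∈ stdSimplex ℝ S) (b : S → ℝ) : (klValues A δ k phat b).Nonempty := by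
  refine ⟨_, phat, hp, ?_, rfl⟩
  have : kl phat phat = 0 := by
    unfold kl
    rw [if_pos fun _ h => h]
    have h0 : ∑ s, phat s * Real.log (phat s / phat s) = 0 :=
      Finset.sum_eq_zero fun s _ => by
        by_cases h : phat s = 0
        · simp [h]
        · simp [div_self h]
    rw [h0, EReal.coe_zero]
  rw [this, mul_zero]
  exact_mod_cast hthr

/-- By Pinsker the KL bounds lie within the relaxed ones, so both versions of the algorithm can be
treated with the relaxed radius. -/
lemma upperB_le {δ : ℝ} {k : ℕ} (hk : k ≠ 0) (hthr : 0 ≤ thr S A δ k) {phat : S → ℝ}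
    (hp : phat ∈ stdSimplex ℝ S) (b : S → ℝ) (kind : BoundKind) :
    upperB A kind δ k phat b ≤ ∑ s', phat s' * b s' + ‖b‖ * √(2 * thr S A δ k / k) := by
  cases kind with
  | relaxed => exact le_rfl
  | kl =>
    refine csSup_le (klValues_nonempty hthr hp b) fun z hz => ?_
    linarith [(abs_le.mp (abs_sub_le_of_mem_klValues hk hp hz)).1]

lemma le_lowerB {δ : ℝ} {k : ℕ} (hk : k ≠ 0) (hthr : 0 ≤ thr S A δ k) {phat : S → ℝ}
    (hp : phat ∈ stdSimplex ℝ S) (b : S → ℝ) (kind : BoundKind) :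
    ∑ s', phat s' * b s' - ‖b‖ * √(2 * thr S A δ k / k) ≤ lowerB A kind δ k phat b := by
  cases kind with
  | relaxed => exact le_rfl
  | kl =>
    refine le_csInf (klValues_nonempty hthr hp b) fun z hz => ?_
    linarith [(abs_le.mp (abs_sub_le_of_mem_klValues hk hp hz)).2]

lemma stopCond_of_isOptBias [Nonempty S] [Nonempty A] (M : AMDP S A) (kind : BoundKind)
    {ε δ : ℝ} {y : ℕ → S → A → S} {k : ℕ} (hk : k ≠ 0) (hthr : 0 ≤ thr S A δ k) {b : S → ℝ}
    (hb : (M.empMDP y k).IsOptBias b)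
    (hε : 2 * (‖b‖ * √(2 * thr S A δ k / k)) ≤ ε) : M.StopCond kind ε δ y k b := by
  obtain ⟨g, -, hg⟩ := hb
  set c := ‖b‖ * √(2 * thr S A δ k / k)
  have hg1 : ∀ s a, M.r s a + ∑ s', empProb y k s a s' * b s' ≤ g + b s := fun s a => by
    rw [hg s]
    exact le_ciSup (f := fun a => M.r s a + ∑ s', empProb y k s a s' * b s')
      (Set.finite_range _).bddAbove a
  have hup : (⨆ s, ⨆ a, (M.r s a + upperB A kind δ k (empProb y k s a) b - b s)) ≤ g + c := by
    refine ciSup_le fun s => ciSup_le fun a => ?_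
    linarith [hg1 s a, upperB_le hk hthr (M.empProb_mem_stdSimplex y k s a) b kind]
  have hlo : g - c ≤ ⨅ s, ⨆ a, (M.r s a + lowerB A kind δ k (empProb y k s a) b - b s) := by
    refine le_ciInf fun s => ?_
    obtain ⟨a, ha⟩ := exists_eq_ciSup_of_finite
      (f := fun a => M.r s a + ∑ s', empProb y k s a s' * b s')
    have h1 : g + b s = M.r s a + ∑ s', empProb y k s a s' * b s' := (hg s).trans ha.symm
    refine le_trans ?_ (le_ciSup (Set.finite_range _).bddAbove a)
    linarith [le_lowerB hk hthr (M.empProb_mem_stdSimplex y k s a) b kind]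
  unfold StopCond
  linarith

/-- If all empirical transition vectors are within their confidence regions, the algorithm stops
as soon as the number of rounds dominates the threshold. -/
lemma stopCond_of_kl_le [Nonempty A] {M : AMDP S A} {s₀ : S} {β : AMDP S A → S → ℝ}
    {ε δ : ℝ} {y : ℕ → S → A → S} {k : ℕ} (kind : BoundKind) (hS : 2 ≤ Fintype.card S)
    (hu : M.Unichain) (hne : ∃ π : S → A, M.gain π ≠ M.optGain) (hβ : IsBiasRoutine s₀ β)
    (hε : 0 < ε) (hδ0 : 0 < δ) (hδ1 : δ < 1) (hk : k ≠ 0)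
    (hthr : thr S A δ k ≤ M.CConst s₀ ε * k)
    (hkl : ∀ s a, ((k : ℝ) : EReal) * kl (empProb y k s a) (M.p s a)
      ≤ ((thr S A δ k : ℝ) : EReal)) :
    M.StopCond kind ε δ y k (β (M.empMDP y k)) := by
  have : Nonempty S := ⟨s₀⟩
  have hk' : (0 : ℝ) < k := by positivity
  have hgap := gap_pos hne
  have hcp := one_le_cplx (M := M) (s₀ := s₀)
  have hmin : 0 < min M.gap ε := lt_min hgap hε
  have hthr0 := thr_nonneg (A := A) hS hδ0 hδ1 k
  set η := √(2 * thr S A δ k / k) with hη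
  have hη0 : 0 ≤ η := Real.sqrt_nonneg _
  -- Here 288 = 2 · 12². The 12 serves twice: it gives Γη ≤ δ₁/12, and it makes 2‖b‖η ≤ ε when ‖b‖
  -- is at most 6 max(H+1,Γ).
  have hηle : η ≤ min M.gap ε / (12 * M.cplx s₀) := by
    refine Real.sqrt_le_left (by positivity) |>.mpr ?_
    rw [div_le_iff₀ hk']
    unfold CConst at hthr
    have : (min M.gap ε / (12 * M.cplx s₀)) ^ 2 * k
        = 2 * (1 / 288 * (min M.gap ε ^ 2 / M.cplx s₀ ^ 2) * k) := by
      field_simp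
      norm_num
    linarith
  have hηc : M.cplx s₀ * η ≤ min M.gap ε / 12 := by
    rw [le_div_iff₀ (by positivity)] at hηle
    linarith
  have hΓ : M.Gam s₀ * η ≤ M.gap / 12 := by
    have h1 : M.Gam s₀ * η ≤ M.cplx s₀ * η := mul_le_mul_of_nonneg_right (le_max_right _ _) hη0
    linarith [min_le_left M.gap ε]
  have hpp : ∀ s a, ∑ s', |M.p s a s' - (M.empMDP y k).p s a s'| ≤ η := fun s a => by
    have := sum_abs_sub_le_sqrt (M.empProb_mem_stdSimplex y k s a)
      ⟨M.p_nonneg s a, M.p_sum s a⟩ hk (hkl s a)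
    refine le_of_eq_of_le (Finset.sum_congr rfl fun s' _ => abs_sub_comm _ _) this
  obtain ⟨hopt, hnorm⟩ := isOptBias_of_perturbation (M' := M.empMDP y k) hβ hu hgap hη0 hΓ rfl hpp
  refine M.stopCond_of_isOptBias kind hk hthr0 hopt ?_
  have h2 := mul_le_mul_of_nonneg_right hnorm hη0
  linarith [min_le_right M.gap ε]

end Stopping

/-! ### Probability of the good event -/

section GoodEvent

variable {S : Type u} {A : Type v} [Fintype S] [DecidableEq S] [Fintype A]
  [MeasurableSpace S] [MeasurableSingletonClass S] {Ω : Type w} [MeasurableSpace Ω]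
  {μ : Measure Ω} {M : AMDP S A} {X : ℕ → S → A → Ω → S}

lemma IsGenerativeModel.measure_cylinder [IsProbabilityMeasure μ] (hX : M.IsGenerativeModel μ X)
    (s : S) (a : A) (x : ℕ → S) (m : ℕ) :
    μ {ω | ∀ i < m, X i s a ω = x i}
      = ENNReal.ofReal (∏ i ∈ Finset.range m, M.p s a (x i)) := by
  have hind : iIndepFun (fun i : ℕ => X i s a) μ :=
    hX.indep.precomp (g := fun i : ℕ => (i, s, a)) fun i j h => (Prod.mk.inj h).1
  have h := hind.measure_inter_preimage_eq_mul (Finset.range m) (sets := fun i => {x i})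
    fun i _ => measurableSet_singleton _
  rw [ENNReal.ofReal_prod_of_nonneg fun i _ => M.p_nonneg _ _ _]
  simp only [hX.law] at h
  rw [← h]
  congr 1
  ext ω
  simp

/-- With probability at least `1 - δ`, all empirical transition vectors are within their
confidence regions in all rounds. -/
lemma IsGenerativeModel.le_measure_kl_le [IsProbabilityMeasure μ] [Nonempty S] [Nonempty A]
    (hX : M.IsGenerativeModel μ X) (hS : 2 ≤ Fintype.card S) {δ : ℝ} (hδ0 : 0 < δ) :
    ENNReal.ofReal (1 - δ) ≤ μ {ω | ∀ k : ℕ, k ≠ 0 → ∀ s a,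
      ((k : ℝ) : EReal) * kl (empProb (fun k s a => X k s a ω) k s a) (M.p s a)
        ≤ ((thr S A δ k : ℝ) : EReal)} := by
  set G := {ω | ∀ k : ℕ, k ≠ 0 → ∀ s a,
      ((k : ℝ) : EReal) * kl (empProb (fun k s a => X k s a ω) k s a) (M.p s a)
        ≤ ((thr S A δ k : ℝ) : EReal)} with hG
  -- Each of the SA pairs is allotted failure probability 1/c = δ/(SA), and log c is the first term
  -- of the threshold.
  set c := (Fintype.card S * Fintype.card A : ℝ) / δ with hc
  have hSA : (0 : ℝ) < Fintype.card S * Fintype.card A := by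
    have := Fintype.card_pos (α := S)
    have := Fintype.card_pos (α := A)
    positivity
  have hcpos : 0 < c := div_pos hSA hδ0
  let B : S × A → Set Ω := fun i => {ω | ∃ n : ℕ, n ≠ 0 ∧
    ¬ ((n : ℝ) : EReal) * kl (fun s => (occ (fun k => X k i.1 i.2 ω) n s : ℝ) / n) (M.p i.1 i.2)
      ≤ ((Real.log c + ((Fintype.card S : ℝ) - 1)
        * Real.log (Real.exp 1 * (1 + (n : ℝ) / ((Fintype.card S : ℝ) - 1))) : ℝ) : EReal)}
  have hB : ∀ i, μ (B i) ≤ ENNReal.ofReal (1 / c) := fun i =>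
    measure_exists_kl_gt_le hS ⟨M.p_nonneg i.1 i.2, M.p_sum i.1 i.2⟩
      (hX.measure_cylinder i.1 i.2)
      (fun k s hs => (hX.law k i.1 i.2 s).trans (by rw [hs, ENNReal.ofReal_zero])) hcpos
  have hsub : Gᶜ ⊆ ⋃ i, B i := by
    intro ω hω
    simp only [hG, Set.mem_compl_iff, Set.mem_ofPred_eq] at hω
    push Not at hω
    obtain ⟨k, hk, s, a, h⟩ := hω
    refine Set.mem_iUnion.mpr ⟨(s, a), k, hk, not_le.mpr ?_⟩
    have : empProb (fun k s a => X k s a ω) k s a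
        = fun s' => (occ (fun i => X i s a ω) k s' : ℝ) / k := by
      funext s'
      simp only [empProb, if_neg hk]
      rfl
    rw [this] at h
    exact h
  have hbad : μ Gᶜ ≤ ENNReal.ofReal δ := by
    calc μ Gᶜ ≤ ∑ i, μ (B i) := (measure_mono hsub).trans (measure_iUnion_fintype_le _ _)
      _ ≤ ∑ _i : S × A, ENNReal.ofReal (1 / c) := Finset.sum_le_sum fun i _ => hB i
      _ = ENNReal.ofReal δ := by
          rw [← ENNReal.ofReal_sum_of_nonneg fun _ _ => by positivity]
          congr 1
          rw [Finset.sum_const, Finset.card_univ, Fintype.card_prod, nsmul_eq_mul, hc]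
          push_cast
          field_simp
  have h1 : 1 ≤ μ G + ENNReal.ofReal δ := by
    rw [← measure_univ (μ := μ), ← Set.union_compl_self G]
    exact (measure_union_le _ _).trans (add_le_add le_rfl hbad)
  rw [ENNReal.ofReal_sub _ hδ0.le, ENNReal.ofReal_one]
  exact tsub_le_iff_right.mpr h1

end GoodEvent

/-! ### Solving for the number of rounds and bounding the rate -/

section Rounds

/-- A number of rounds that dominates the threshold. -/
lemma exists_nat_add_log_le_mul {d y C : ℝ} (hd : 1 ≤ d) (hy : 1 ≤ y) (hC0 : 0 < C)
    (hC : C ≤ 1 / 288) :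
    ∃ k : ℕ, k ≠ 0 ∧ (k : ℝ) < d * (y / C) * (1 + 2 / y * Real.log ((y + 2) / C)) ∧
      d * (y + Real.log (1 + k / d)) ≤ C * k := by
  set Z := (y + 2) / C with hZ
  have hZC : Z * C = y + 2 := by rw [hZ]; field_simp
  have hZpos : 0 < Z := by positivity
  have hZ288 : 288 * (y + 2) ≤ Z := by nlinarith
  have hlogZ : Real.log Z ≤ Z / 2 := by
    have h1 := Real.log_le_sub_one_of_pos (show 0 < Z / 2 by positivity)
    rw [Real.log_div hZpos.ne' (by norm_num)] at h1
    have h2 : Real.log 2 ≤ 1 := by linarith [Real.log_two_lt_d9]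
    linarith
  have hlog0 : 0 < Real.log Z := Real.log_pos (by linarith)
  set t := (y + 2 * Real.log Z) / C with ht
  have htC : t * C = y + 2 * Real.log Z := by rw [ht]; field_simp
  have hteq : d * (y / C) * (1 + 2 / y * Real.log Z) = d * t := by
    rw [ht]
    field_simp
  have ht2 : 2 ≤ t := by nlinarith
  -- The extra `C` pays for rounding: `k` is the largest integer strictly below d t, hence at least
  -- d t - 1. The room comes from 2(1 + t) ≤ Z² and C < log 2.
  have hlog : Real.log (1 + t) + C ≤ 2 * Real.log Z := by
    have h1 : 2 * (1 + t) ≤ Z ^ 2 := by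
      have h2 : C * (2 * (1 + t)) ≤ C * Z ^ 2 := by
        have e1 : C * Z ^ 2 = Z * (y + 2) := by rw [← hZC]; ring
        have e2 : C * (2 * (1 + t)) = 2 * C + 2 * (y + 2 * Real.log Z) := by rw [← htC]; ring
        rw [e1, e2]
        nlinarith
      exact le_of_mul_le_mul_left h2 hC0
    have h3 := Real.log_le_log (by positivity) h1
    rw [Real.log_mul (by norm_num) (by positivity), Real.log_pow] at h3
    push_cast at h3
    linarith [Real.log_two_gt_d9]
  have hdt : 2 ≤ d * t := by nlinarith
  obtain ⟨k, hk⟩ : ∃ k : ℕ, k + 1 = ⌈d * t⌉₊ :=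
    ⟨⌈d * t⌉₊ - 1, Nat.sub_add_cancel (Nat.one_le_ceil_iff.mpr (by linarith))⟩
  have hk1 : d * t ≤ k + 1 := by
    have := Nat.le_ceil (d * t)
    rw [← hk] at this
    exact_mod_cast this
  have hk2 : (k : ℝ) < d * t := Nat.lt_ceil.mp (by omega)
  refine ⟨k, ?_, hteq ▸ hk2, ?_⟩
  · rintro rfl
    norm_num at hk1
    linarith
  · have hd0 : 0 < d := by linarith
    have h1 : Real.log (1 + k / d) ≤ Real.log (1 + t) := by
      refine Real.log_le_log (by positivity) ?_
      have : (k : ℝ) / d ≤ t := by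
        rw [div_le_iff₀ hd0]
        linarith
      linarith
    have h2 : C * (d * t - 1) ≤ C * k := mul_le_mul_of_nonneg_left (by linarith) hC0.le
    have h3 : C * (d * t - 1) = d * (y + 2 * Real.log Z) - C := by rw [← htC]; ring
    have h4 : d * (y + Real.log (1 + k / d)) ≤ d * (y + (2 * Real.log Z - C)) :=
      mul_le_mul_of_nonneg_left (by linarith) hd0.le
    nlinarith

variable {S : Type u} {A : Type v} [Fintype S] [DecidableEq S] [Fintype A] {M : AMDP S A} {s₀ : S}

lemma CConst_pos (hgap : 0 < M.gap) {ε : ℝ} (hε : 0 < ε) : 0 < M.CConst s₀ ε := by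
  have h1 := one_le_cplx (M := M) (s₀ := s₀)
  have h2 : 0 < min M.gap ε := lt_min hgap hε
  unfold CConst
  positivity

lemma CConst_le (hgap : 0 < M.gap) {ε : ℝ} (hε : 0 < ε) (hε1 : ε < 1) :
    M.CConst s₀ ε ≤ 1 / 288 := by
  have h1 := one_le_cplx (M := M) (s₀ := s₀)
  have h2 : 0 < min M.gap ε := lt_min hgap hε
  have h3 : min M.gap ε ≤ 1 := (min_le_right _ _).trans hε1.le
  have h4 : min M.gap ε ^ 2 / M.cplx s₀ ^ 2 ≤ 1 := by
    rw [div_le_one (by positivity)]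
    nlinarith
  unfold CConst
  linarith

lemma one_le_yConst (hS : 2 ≤ Fintype.card S) [Nonempty A] {δ : ℝ} (h0 : 0 < δ) (h1 : δ < 1) :
    1 ≤ yConst S A δ := by
  have hS' : (2 : ℝ) ≤ Fintype.card S := by exact_mod_cast hS
  have hA : (1 : ℝ) ≤ Fintype.card A := by exact_mod_cast Fintype.card_pos (α := A)
  have : 0 ≤ Real.log ((Fintype.card S * Fintype.card A : ℝ) / δ) := by
    refine Real.log_nonneg ?_
    rw [one_le_div h0]
    nlinarith
  unfold yConst
  have := div_nonneg this (show (0 : ℝ) ≤ (Fintype.card S : ℝ) - 1 by linarith)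
  linarith

lemma exists_round (hS : 2 ≤ Fintype.card S) [Nonempty A] (hgap : 0 < M.gap) {ε δ : ℝ}
    (hε : 0 < ε) (hε1 : ε < 1) (hδ0 : 0 < δ) (hδ1 : δ < 1) :
    ∃ k : ℕ, k ≠ 0 ∧ thr S A δ k ≤ M.CConst s₀ ε * k ∧
      ((k * (Fintype.card S * Fintype.card A) : ℕ) : ℝ) < M.explicitBound s₀ ε δ := by
  have hS' : (2 : ℝ) ≤ Fintype.card S := by exact_mod_cast hS
  have hA : (0 : ℝ) < Fintype.card A := by exact_mod_cast Fintype.card_pos (α := A)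
  have hd : (1 : ℝ) ≤ (Fintype.card S : ℝ) - 1 := by linarith
  obtain ⟨k, hk, hlt, hle⟩ := exists_nat_add_log_le_mul hd (one_le_yConst (A := A) hS hδ0 hδ1)
    (CConst_pos (s₀ := s₀) hgap hε) (CConst_le hgap hε hε1)
  refine ⟨k, hk, ?_, ?_⟩
  · refine le_of_eq_of_le ?_ hle
    have h1 : (0 : ℝ) < 1 + (k : ℝ) / ((Fintype.card S : ℝ) - 1) := by positivity
    unfold thr yConst
    rw [Real.log_mul (Real.exp_pos 1).ne' h1.ne', Real.log_exp]
    field_simp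
    ring
  · unfold explicitBound
    push_cast
    have h2 := mul_lt_mul_of_pos_left hlt
      (show (0 : ℝ) < Fintype.card S * Fintype.card A by positivity)
    linarith

/-- The explicit bound is dominated by the rate, up to a universal constant. -/
lemma explicitBound_le (hS : 2 ≤ Fintype.card S) [Nonempty A] (hgap : 0 < M.gap) {ε δ : ℝ}
    (hε : 0 < ε) (hε1 : ε < 1) (hδ0 : 0 < δ) (hδ1 : δ < 1) (hεgap : ε ≤ M.gap) :
    M.explicitBound s₀ ε δ ≤ 288 * 24 * M.mainRate s₀ ε δ * M.logFactor s₀ ε δ := by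
  have hcp := one_le_cplx (M := M) (s₀ := s₀)
  have hC0 := CConst_pos (s₀ := s₀) hgap hε
  have hy := one_le_yConst (A := A) hS hδ0 hδ1
  have hCeq : M.CConst s₀ ε = ε ^ 2 / (288 * M.cplx s₀ ^ 2) := by
    unfold CConst
    rw [min_eq_right hεgap]
    field_simp
  have hn2 : (2 : ℝ) ≤ (Fintype.card S : ℝ) := by exact_mod_cast hS
  have hm1 : (1 : ℝ) ≤ (Fintype.card A : ℝ) := by
    exact_mod_cast Fintype.card_pos (α := A)
  unfold explicitBound mainRate logFactor
  set n : ℝ := (Fintype.card S : ℝ) with hn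
  set m : ℝ := (Fintype.card A : ℝ) with hm
  set c := M.cplx s₀
  set C := M.CConst s₀ ε
  set y := yConst S A δ with hydef
  set l := Real.log (1 / δ) with hl
  have hl0 : 0 ≤ l := Real.log_nonneg (by rw [one_le_div hδ0]; exact hδ1.le)
  -- `F` is the argument of the logarithmic factor without e. It dominates nm, c/ε and, up to a
  -- factor 3, y + 2, so that (y + 2)/C ≤ 864 F³.
  set F := n * m * c * (1 + l) / ε with hF
  have hnm : 2 ≤ n * m := by nlinarith
  have hF1 : n * m * (1 + l) ≤ F := by
    rw [hF, le_div_iff₀ hε]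
    nlinarith [mul_nonneg (show 0 ≤ n * m by positivity) (show 0 ≤ 1 + l by positivity),
      mul_le_mul_of_nonneg_left hcp (show 0 ≤ n * m * (1 + l) by positivity)]
  have hF2 : n * m ≤ F := by nlinarith
  have hcF : c / ε ≤ F := by
    rw [hF, div_le_div_iff_of_pos_right hε]
    have h1 : 1 ≤ n * m * (1 + l) := by nlinarith
    have h2 := mul_le_mul_of_nonneg_left h1 (show 0 ≤ c by linarith)
    linarith
  have hFpos : 0 < F := by linarith
  have hLF : Real.log (Real.exp 1 * n * m * c * (1 + l) / ε) = 1 + Real.log F := by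
    rw [← Real.log_exp 1, ← Real.log_mul (Real.exp_pos 1).ne' hFpos.ne', Real.log_exp, hF]
    congr 1
    ring
  have hlogF : 0 ≤ Real.log F := Real.log_nonneg (by linarith)
  have hlnm : Real.log (n * m) ≤ Real.log F := Real.log_le_log (by linarith) hF2
  have hlSA : Real.log (n * m / δ) = Real.log (n * m) + l := by
    rw [hl, div_eq_mul_one_div, Real.log_mul (by positivity) (by positivity)]
  have hdy : (n - 1) * y = (n - 1) + (Real.log (n * m) + l) := by
    have : n - 1 ≠ 0 := by linarith
    rw [hydef, yConst, ← hn, ← hm, hlSA]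
    field_simp
  have hy2 : y + 2 ≤ 3 * F := by
    have h1 : Real.log (n * m) ≤ n * m - 1 := Real.log_le_sub_one_of_pos (by linarith)
    have h2 : 0 ≤ Real.log (n * m) := Real.log_nonneg (by linarith)
    have h3 : y ≤ 1 + (Real.log (n * m) + l) := by nlinarith
    nlinarith
  have hZ : Real.log ((y + 2) / C) ≤ 7 + 3 * Real.log F := by
    have h1 : (y + 2) / C ≤ 864 * F ^ 3 := by
      have h2 : (y + 2) / C = 288 * ((y + 2) * (c / ε) ^ 2) := by
        rw [hCeq]
        field_simp
      have h3 : (c / ε) ^ 2 ≤ F ^ 2 := pow_le_pow_left₀ (by positivity) hcF 2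
      have h4 : (y + 2) * (c / ε) ^ 2 ≤ 3 * F * F ^ 2 :=
        mul_le_mul hy2 h3 (by positivity) (by positivity)
      rw [h2]
      linarith
    refine (Real.log_le_log (by positivity) h1).trans ?_
    rw [Real.log_mul (by norm_num) (by positivity), Real.log_pow]
    have h5 : Real.log 864 ≤ 7 := by
      rw [Real.log_le_iff_le_exp (by norm_num), show (7 : ℝ) = (7 : ℕ) * 1 by norm_num,
        Real.exp_nat_mul]
      have h6 : (2.7 : ℝ) ^ 7 ≤ Real.exp 1 ^ 7 :=
        pow_le_pow_left₀ (by norm_num) (by linarith [Real.exp_one_gt_d9]) 7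
      norm_num at h6 ⊢
      linarith
    push_cast
    linarith
  have hmain : (n - 1) * y + 2 * (n - 1) * Real.log ((y + 2) / C)
      ≤ 24 * (l + n) * (1 + Real.log F) := by
    rw [hdy]
    have h1 := mul_le_mul_of_nonneg_left hZ (show 0 ≤ 2 * (n - 1) by linarith)
    nlinarith [mul_nonneg hl0 hlogF, mul_nonneg (show 0 ≤ n by linarith) hlogF]
  have hlhs : n * m * (n - 1) * (y / C) * (1 + 2 / y * Real.log ((y + 2) / C))
      = 288 * (n * m * c ^ 2 / ε ^ 2)
        * ((n - 1) * y + 2 * (n - 1) * Real.log ((y + 2) / C)) := by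
    rw [show n * m * (n - 1) * (y / C) * (1 + 2 / y * Real.log ((y + 2) / C))
      = n * m / C * ((n - 1) * y + 2 * (n - 1) * Real.log ((y + 2) / C)) by field_simp, hCeq]
    congr 1
    field_simp
  rw [hlhs, hLF]
  have := mul_le_mul_of_nonneg_left hmain
    (show 0 ≤ 288 * (n * m * c ^ 2 / ε ^ 2) by positivity)
  refine this.trans (le_of_eq ?_)
  ring

/-- The algorithm may stop before round `k`. The infimum turns validity of the condition at a single
round into a bound, and excludes the value ⊤. -/
lemma sampleComplexity_le_of_stopCond {kind : BoundKind} {ε δ : ℝ} {β : AMDP S A → S → ℝ}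
    {y : ℕ → S → A → S} {k : ℕ} (hk : k ≠ 0)
    (h : M.StopCond kind ε δ y k (β (M.empMDP y k))) :
    ∃ n : ℕ, M.sampleComplexity kind ε δ β y = (n : ℕ∞) ∧
      n ≤ k * (Fintype.card S * Fintype.card A) := by
  have hle : M.sampleComplexity kind ε δ β y
      ≤ ((k * (Fintype.card S * Fintype.card A) : ℕ) : ℕ∞) :=
    sInf_le ⟨k, Nat.one_le_iff_ne_zero.mpr hk, h, rfl⟩
  obtain ⟨n, hn⟩ := ENat.ne_top_iff_exists.mp (ne_top_of_le_ne_top (ENat.natCast_ne_top _) hle)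
  rw [← hn] at hle
  exact ⟨n, hn.symm, by exact_mod_cast hle⟩

end Rounds

end AMDP

theorem mainTheorem7 :
    ∃ K : ℝ, 0 < K ∧
      ∀ (S : Type u) (A : Type v) [Fintype S] [DecidableEq S] [Fintype A]
        [MeasurableSpace S] [MeasurableSingletonClass S]
        (Ω : Type w) [MeasurableSpace Ω] (μ : Measure Ω) [IsProbabilityMeasure μ]
        (M : AMDP S A) (s₀ : S) (X : ℕ → S → A → Ω → S)
        (β : AMDP S A → S → ℝ) (kind : AMDP.BoundKind) (ε δ : ℝ),
        2 ≤ Fintype.card S →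
        M.Unichain →
        (∃ π : S → A, M.gain π ≠ M.optGain) →
        M.IsGenerativeModel μ X →
        AMDP.IsBiasRoutine s₀ β →
        0 < ε → ε < 1 → 0 < δ → δ < 1 →
        (ENNReal.ofReal (1 - δ) ≤
          μ {ω | ∃ n : ℕ,
            M.sampleComplexity kind ε δ β (fun k s a => X k s a ω) = (n : ℕ∞) ∧
              (n : ℝ) < M.explicitBound s₀ ε δ}) ∧
        (ε ≤ M.gap →
          ENNReal.ofReal (1 - δ) ≤
            μ {ω | ∃ n : ℕ,
              M.sampleComplexity kind ε δ β (fun k s a => X k s a ω) = (n : ℕ∞) ∧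
                (n : ℝ) ≤ K * M.mainRate s₀ ε δ * M.logFactor s₀ ε δ}) := by
  refine ⟨288 * 24, by norm_num, ?_⟩
  intro S A _ _ _ _ _ Ω _ μ _ M s₀ X β kind ε δ hS hu hne hX hβ hε hε1 hδ0 hδ1
  have hNS : Nonempty S := ⟨s₀⟩
  have hNA : Nonempty A := hne.elim fun π _ => ⟨π s₀⟩
  have hgap := AMDP.gap_pos hne
  -- This round is fixed before the samples are drawn, and the good event is used at it only.
  obtain ⟨k, hk, hthr, hlt⟩ := AMDP.exists_round (s₀ := s₀) hS hgap hε hε1 hδ0 hδ1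
  have main : ENNReal.ofReal (1 - δ) ≤ μ {ω | ∃ n : ℕ,
      M.sampleComplexity kind ε δ β (fun k s a => X k s a ω) = (n : ℕ∞) ∧
        (n : ℝ) < M.explicitBound s₀ ε δ} := by
    refine (hX.le_measure_kl_le hS hδ0).trans (measure_mono fun ω hω => ?_)
    obtain ⟨n, hn, hle⟩ := AMDP.sampleComplexity_le_of_stopCond hk
      (AMDP.stopCond_of_kl_le kind hS hu hne hβ hε hδ0 hδ1 hk hthr (hω k hk))
    exact ⟨n, hn, lt_of_le_of_lt (by exact_mod_cast hle) hlt⟩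
  refine ⟨main, fun hεgap => main.trans (measure_mono ?_)⟩
  rintro ω ⟨n, hn, hnlt⟩
  exact ⟨n, hn, hnlt.le.trans (AMDP.explicitBound_le hS hgap hε hε1 hδ0 hδ1 hεgap)⟩
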